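/- In the $(1:b)$ Maker-Breaker Hamilton cycle game on the complete graph $K_n$, where $b \ge 0$ is an integer, two players, Breaker and Maker, alternately claim previously unclaimed edges of $K_n$, with Breaker moving first. In each of his turns Breaker claims $b$ edges (all the remaining edges, if fewer than $b$ remain), and in each of her turns Maker claims one edge. Maker wins once the edges she has claimed contain a Hamilton cycle of $K_n$. Theorem. There is a constant $C > 0$ such that for all sufficiently large $n$ and every integer $b$ with $0 \le b \le \frac{n}{\ln n} - \frac{Cn}{(\ln n)^{3/2}}$, Maker has a strategy that guarantees that she wins the $(1:b)$ Hamilton cycle game on $K_n$ within her first $n + \frac{Cn}{\sqrt{\ln n}}$ moves, however Breaker plays. -/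

import Mathlib

namespace HamiltonGame

variable {V : Type*} [Fintype V] [DecidableEq V]

/-- The edges of the complete graph on `V` that neither Maker, who owns `M`, nor Breaker, who
owns `B`, has claimed. -/
def freeEdges (M B : Finset (Sym2 V)) : Finset (Sym2 V) :=
  (⊤ : SimpleGraph V).edgeFinset \ (M ∪ B)

/-- The edge set `M` contains the edges of a Hamilton cycle on `V`. -/
def HasHamiltonCycle (M : Finset (Sym2 V)) : Prop :=
  ∃ (v : V) (p : (SimpleGraph.fromEdgeSet (M : Set (Sym2 V))).Walk v v), p.IsHamiltonianCycle

/-- `X` is a legal turn of Breaker with bias `b` when `F` is the set of unclaimed edges: he claims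
exactly `b` of them, or all of them if there are fewer than `b`. -/
def IsBreakerTurn (b : ℕ) (F X : Finset (Sym2 V)) : Prop :=
  X ⊆ F ∧ X.card = min b F.card

/-- In the position where Maker owns `M`, Breaker owns `B` and Breaker is to move, Maker can force
a win of the `(1 : b)` Hamilton cycle game within at most `k` further moves of hers. Either she
owns a Hamilton cycle already, or, whatever legal turn Breaker makes, she can answer by claiming
one unclaimed edge so that she can force a win within `k - 1` further moves. -/
def MakerWinsFrom (b : ℕ) : ℕ → Finset (Sym2 V) → Finset (Sym2 V) → Prop
  | 0, M, _ => HasHamiltonCycle M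
  | k + 1, M, B => HasHamiltonCycle M ∨
      ∀ X : Finset (Sym2 V), IsBreakerTurn b (freeEdges M B) X →
        ∃ e ∈ freeEdges M (B ∪ X), MakerWinsFrom b k (insert e M) (B ∪ X)

/-- Maker can win the `(1 : b)` Hamilton cycle game on the complete graph on `Fin n`, Breaker
moving first, within at most `k` moves of hers. -/
def MakerWinsWithin (n b k : ℕ) : Prop :=
  MakerWinsFrom (V := Fin n) b k ∅ ∅

end HamiltonGame

/-!
# Maker wins the biased Hamilton cycle game quickly

Write `L = ln n`, and let `s` be about `n / √L`. Since `b ≤ n / L`, Breaker claims at most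
`2 s ^ 2` edges in the whole game, while the error term in the bound on `b` leaves room for a large
multiple of `s` in every count of vertices. Maker maintains a linear forest `F` of her edges, and a
vertex is urgent once Breaker has more than `s` edges there; this happens to at most `4 s`
vertices.

*Urgent moves.* If after Breaker's turn some urgent vertex has degree less than two in `F`, Maker
takes such a vertex `v` that maximizes `deg B v - b * deg F v` and joins it to a vertex `x` away
from all urgent vertices. An edge of `F` at `x` may have to be deleted from `F`, but
urgent vertices never lose forest edges, so there are `O(s)` urgent moves. As in the box game, the
danger of a set of `k` such vertices stays below `k` times `b * (1 + ln (n / k)) + O(s)`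
(`BoxBounded.grow`, `BoxBounded.tend`). Hence Breaker's degree at `v` stays below `n - Ω(s)`, and
there is a choice for `x` (`Invariant.exists_urgent_move`). Counting in `touch` the edges
inside a set once only is what makes the leading term `b * ln n`, and not `2 * b * ln n`.

*Core.* The other moves are free. Maker first plays inside a set `W` of `200 s` vertices with a
subset `P` of `100 s` pivots. Breaker does not have enough edges to block a pair of disjoint
`3 s`-subsets of `W` and `P`, so some edge joins a constant proportion of the pairs that are not
yet joined, and after `O(s)` moves all of them are joined (`exists_core_edge`). Discarding `O(s)`
vertices turns `W` into an expander (`exists_expander`). The vertices of the expander need no more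
care, and the discarded ones are treated as urgent from then on.

*Forest.* While the forest has many ends outside the core, two of its paths can be joined, because
an end is not urgent and misses at most `s` vertices on account of Breaker. The `O(s)` ends that
finally remain are joined to distinct core vertices other than pivots. This phase takes `n + O(s)`
moves in all (`AttachingPhase.makerWinsFrom`).

*Boosters.* Now consider paths that consist of core vertices and entire components of `F`. Pósa
rotations at pivots break no forest edge, so expansion gives a longest such path at least `3 s`
ends for each fixed first vertex (`lt_card_rotationEnds`). This makes more than `2 s ^ 2` pairs of
ends, and Maker claims one that is unclaimed: the resulting cycle either is a Hamilton cycle or can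
be opened to give a longer path (`exists_booster`). After at most `200 s + 1` such moves Maker has
won.
-/

namespace HamiltonGame

set_option linter.unusedSectionVars false

/-! ### Degrees in edge sets -/

section Degrees

variable {V : Type*} [DecidableEq V]

/-- The number of edges of `S` at the vertex `v`. -/
def deg (S : Finset (Sym2 V)) (v : V) : ℕ := (S.filter (v ∈ ·)).card

/-- The number of edges of `S` that meet the vertex set `A`; an edge inside `A` counts once. -/
def touch (S : Finset (Sym2 V)) (A : Finset V) : ℕ := (S.filter (fun e => ∃ v ∈ A, v ∈ e)).card

theorem deg_mono {S S' : Finset (Sym2 V)} (h : S ⊆ S') (v : V) : deg S v ≤ deg S' v :=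
  Finset.card_le_card (Finset.filter_subset_filter _ h)

theorem deg_insert {S : Finset (Sym2 V)} {e : Sym2 V} (he : e ∉ S) (v : V) :
    deg (insert e S) v = deg S v + if v ∈ e then 1 else 0 := by
  unfold deg
  rw [Finset.filter_insert]
  split_ifs with h
  · rw [Finset.card_insert_of_notMem (by simp [he])]
  · rfl

theorem deg_erase {S : Finset (Sym2 V)} {e : Sym2 V} (he : e ∈ S) (v : V) :
    deg (S.erase e) v + (if v ∈ e then 1 else 0) = deg S v := by
  conv_rhs => rw [← Finset.insert_erase he]
  rw [deg_insert (Finset.notMem_erase e S)]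

theorem deg_union_le (S S' : Finset (Sym2 V)) (v : V) : deg (S ∪ S') v ≤ deg S v + deg S' v := by
  unfold deg
  rw [Finset.filter_union]
  exact Finset.card_union_le _ _

theorem deg_le_card (S : Finset (Sym2 V)) (v : V) : deg S v ≤ S.card :=
  Finset.card_filter_le _ _

theorem deg_pos {S : Finset (Sym2 V)} {e : Sym2 V} {v : V} (he : e ∈ S) (hv : v ∈ e) :
    0 < deg S v :=
  Finset.card_pos.2 ⟨e, by simp [he, hv]⟩

theorem two_le_deg {S : Finset (Sym2 V)} {e f : Sym2 V} {v : V} (he : e ∈ S) (hf : f ∈ S)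
    (hev : v ∈ e) (hfv : v ∈ f) (hne : e ≠ f) : 2 ≤ deg S v :=
  Finset.one_lt_card.2 ⟨e, by simp [he, hev], f, by simp [hf, hfv], hne⟩

theorem exists_mem_of_deg_pos {S : Finset (Sym2 V)} {v : V} (h : 0 < deg S v) :
    ∃ x, s(v, x) ∈ S := by
  obtain ⟨e, he⟩ := Finset.card_pos.1 h
  rw [Finset.mem_filter] at he
  obtain ⟨x, rfl⟩ := Sym2.mem_iff_exists.1 he.2
  exact ⟨x, he.1⟩

theorem card_neighbors_le [Fintype V] (S : Finset (Sym2 V)) (v : V) :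
    (Finset.univ.filter fun x => s(v, x) ∈ S).card ≤ deg S v := by
  apply Finset.card_le_card_of_injOn (fun x => s(v, x))
  · intro x hx
    simpa using hx
  · intro x _ y _ h
    exact Sym2.congr_right.1 h

theorem card_vertices_of_edge [Fintype V] {e : Sym2 V} (he : ¬ e.IsDiag) :
    (Finset.univ.filter (· ∈ e)).card = 2 := by
  rw [← Sym2.card_toFinset_of_not_isDiag e he]
  congr 1
  ext; simp

/-- The handshake identity. -/
theorem sum_deg [Fintype V] {S : Finset (Sym2 V)} (hS : ∀ e ∈ S, ¬ e.IsDiag) :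
    ∑ v, deg S v = 2 * S.card := by
  unfold deg
  have : ∀ v : V, (S.filter (v ∈ ·)).card = ∑ e ∈ S, if v ∈ e then 1 else 0 := by
    intro v; rw [Finset.card_filter]
  simp_rw [this]
  rw [Finset.sum_comm, Finset.sum_congr rfl (g := fun _ => 2)]
  · simp [mul_comm]
  · intro e he
    rw [← Finset.card_filter, card_vertices_of_edge (hS e he)]

/-- Few vertices have large degree. -/
theorem card_filter_lt_deg_mul_le [Fintype V] {S : Finset (Sym2 V)} (hS : ∀ e ∈ S, ¬ e.IsDiag)
    (t : ℕ) : (Finset.univ.filter fun v => t < deg S v).card * (t + 1) ≤ 2 * S.card := by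
  rw [← sum_deg hS, ← smul_eq_mul]
  refine (Finset.card_nsmul_le_sum _ _ _ fun v hv => ?_).trans
    (Finset.sum_le_sum_of_subset (Finset.subset_univ _))
  exact (Finset.mem_filter.1 hv).2

theorem touch_le_sum_deg (S : Finset (Sym2 V)) (A : Finset V) :
    touch S A ≤ ∑ v ∈ A, deg S v := by
  unfold touch deg
  refine (Finset.card_le_card (t := A.biUnion fun v => S.filter (v ∈ ·)) ?_).trans
    Finset.card_biUnion_le
  intro e he
  simp only [Finset.mem_filter, Finset.mem_biUnion] at he ⊢
  obtain ⟨h1, v, hv, hve⟩ := he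
  exact ⟨v, hv, h1, hve⟩

theorem touch_singleton (S : Finset (Sym2 V)) (v : V) : touch S {v} = deg S v := by
  simp [touch, deg]

theorem touch_union_le (S S' : Finset (Sym2 V)) (A : Finset V) :
    touch (S ∪ S') A ≤ touch S A + S'.card := by
  unfold touch
  rw [Finset.filter_union]
  exact (Finset.card_union_le _ _).trans
    (Nat.add_le_add_left (Finset.card_filter_le _ _) _)

theorem touch_le_touch_add_sum (S : Finset (Sym2 V)) (A A' : Finset V) :
    touch S (A ∪ A') ≤ touch S A + ∑ v ∈ A', deg S v := by
  refine le_trans ?_ (Nat.add_le_add_left (touch_le_sum_deg S A') _)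
  unfold touch
  refine le_trans (Finset.card_le_card ?_) (Finset.card_union_le _ _)
  intro e he
  simp only [Finset.mem_filter, Finset.mem_union] at he ⊢
  obtain ⟨h1, v, hv | hv, hve⟩ := he
  · exact .inl ⟨h1, v, hv, hve⟩
  · exact .inr ⟨h1, v, hv, hve⟩

/-- Adding a vertex `v` to `A` gains all edges at `v` except the at most `A.card` edges that join
`v` to `A`. -/
theorem touch_add_deg_le (S : Finset (Sym2 V)) {A : Finset V} {v : V} (hv : v ∉ A) :
    touch S A + deg S v ≤ touch S (insert v A) + A.card := by
  unfold touch deg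
  have h := Finset.card_union_add_card_inter (S.filter fun e => ∃ u ∈ A, u ∈ e) (S.filter (v ∈ ·))
  rw [← h]
  refine Nat.add_le_add (Finset.card_le_card ?_) ?_
  · intro e he
    simp only [Finset.mem_union, Finset.mem_filter, Finset.mem_insert] at he ⊢
    rcases he with ⟨h1, u, hu, hue⟩ | ⟨h1, h2⟩
    · exact ⟨h1, u, .inr hu, hue⟩
    · exact ⟨h1, v, .inl rfl, h2⟩
  · refine (Finset.card_le_card (t := A.image fun u => s(u, v)) ?_).trans Finset.card_image_le
    intro e he
    simp only [Finset.mem_inter, Finset.mem_filter, Finset.mem_image] at he ⊢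
    obtain ⟨⟨_, u, hu, hue⟩, _, hve⟩ := he
    refine ⟨u, hu, ?_⟩
    have : u ≠ v := by rintro rfl; exact hv hu
    exact ((Sym2.mem_and_mem_iff this).1 ⟨hue, hve⟩).symm

end Degrees

/-! ### Paths as lists, and linear forests -/

section Paths

variable {V : Type*} [DecidableEq V]

/-- The edges of the path that visits the vertices of a list in order. -/
def pathEdges : List V → Finset (Sym2 V)
  | [] => ∅
  | [_] => ∅
  | x :: y :: l => insert s(x, y) (pathEdges (y :: l))

@[simp] theorem pathEdges_nil : pathEdges ([] : List V) = ∅ := rfl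
@[simp] theorem pathEdges_singleton (x : V) : pathEdges [x] = ∅ := rfl
@[simp] theorem pathEdges_cons_cons (x y : V) (l : List V) :
    pathEdges (x :: y :: l) = insert s(x, y) (pathEdges (y :: l)) := rfl

theorem pathEdges_append_cons (l₁ : List V) (x : V) (l₂ : List V) :
    pathEdges (l₁ ++ x :: l₂) = pathEdges (l₁ ++ [x]) ∪ pathEdges (x :: l₂) := by
  induction l₁ with
  | nil => simp
  | cons a l ih =>
    cases l with
    | nil => simp
    | cons b l => simpa using congrArg (insert s(a, b)) ih

theorem pathEdges_append_cons_cons (l₁ : List V) (x y : V) (l₂ : List V) :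
    pathEdges (l₁ ++ x :: y :: l₂) =
      insert s(x, y) (pathEdges (l₁ ++ [x]) ∪ pathEdges (y :: l₂)) := by
  rw [pathEdges_append_cons, pathEdges_cons_cons, Finset.union_insert]

theorem pathEdges_reverse (l : List V) : pathEdges l.reverse = pathEdges l := by
  induction l with
  | nil => rfl
  | cons a l ih =>
    cases l with
    | nil => rfl
    | cons b l =>
      have h : (a :: b :: l).reverse = l.reverse ++ b :: a :: [] := by simp
      rw [h, pathEdges_append_cons_cons]
      rw [show l.reverse ++ [b] = (b :: l).reverse by simp, ih]
      simp [Sym2.eq_swap]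

theorem mem_of_mem_pathEdges {l : List V} {e : Sym2 V} {v : V} (he : e ∈ pathEdges l)
    (hv : v ∈ e) : v ∈ l := by
  induction l with
  | nil => simp at he
  | cons a l ih =>
    cases l with
    | nil => simp at he
    | cons b l =>
      rw [pathEdges_cons_cons, Finset.mem_insert] at he
      rcases he with rfl | he
      · rw [Sym2.mem_iff] at hv
        rcases hv with rfl | rfl <;> simp
      · exact List.mem_cons_of_mem _ (ih he)

theorem deg_pathEdges_head {x : V} {l : List V} (h : (x :: l).Nodup) :
    deg (pathEdges (x :: l)) x = if l = [] then 0 else 1 := by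
  cases l with
  | nil => simp [deg]
  | cons y l =>
    rw [List.nodup_cons] at h
    have h0 : ∀ e ∈ pathEdges (y :: l), x ∉ e := fun e he hx => h.1 (mem_of_mem_pathEdges he hx)
    rw [pathEdges_cons_cons, deg_insert fun hm => h0 _ hm (by simp)]
    have : deg (pathEdges (y :: l)) x = 0 := by
      unfold deg
      rw [Finset.card_eq_zero, Finset.filter_eq_empty_iff]
      exact fun e he => h0 e he
    simp [this]

theorem deg_pathEdges_last {x : V} {l : List V} (h : (l ++ [x]).Nodup) :
    deg (pathEdges (l ++ [x])) x = if l = [] then 0 else 1 := by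
  have h1 : (l ++ [x]).reverse = x :: l.reverse := by simp
  rw [← pathEdges_reverse, h1, deg_pathEdges_head (by rw [← h1]; exact List.nodup_reverse.2 h)]
  simp

/-- On a path, inner vertices have degree two and ends have degree one. -/
theorem deg_pathEdges {x : V} {l₁ l₂ : List V} (h : (l₁ ++ x :: l₂).Nodup) :
    deg (pathEdges (l₁ ++ x :: l₂)) x =
      (if l₁ = [] then 0 else 1) + (if l₂ = [] then 0 else 1) := by
  have h1 : (l₁ ++ [x]).Nodup := by
    refine h.sublist ?_
    simp
  have h2 : (x :: l₂).Nodup := h.sublist (by simp)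
  rw [← deg_pathEdges_last h1, ← deg_pathEdges_head h2, pathEdges_append_cons]
  unfold deg
  rw [Finset.filter_union, Finset.card_union_of_disjoint]
  rw [Finset.disjoint_left]
  intro e he he'
  rw [Finset.mem_filter] at he he'
  obtain ⟨y, rfl⟩ := Sym2.mem_iff_exists.1 he.2
  have hy1 := mem_of_mem_pathEdges he.1 (Sym2.mem_mk_right x y)
  have hy2 := mem_of_mem_pathEdges he'.1 (Sym2.mem_mk_right x y)
  have hxy : y = x := by
    by_contra hne
    rw [List.mem_append, List.mem_singleton] at hy1
    rw [List.mem_cons] at hy2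
    exact (List.nodup_append.1 h).2.2 y (hy1.resolve_right hne) y
      (List.mem_cons_of_mem _ (hy2.resolve_left hne)) rfl
  subst hxy
  -- a path on distinct vertices has no loop
  have hl : ∀ l : List V, l.Nodup → s(y, y) ∉ pathEdges l := by
    intro l
    induction l with
    | nil => simp
    | cons a l ih =>
      cases l with
      | nil => simp
      | cons b l =>
        intro hn hm
        rw [pathEdges_cons_cons, Finset.mem_insert] at hm
        rcases hm with hm | hm
        · rw [Sym2.eq_iff] at hm
          have : a = b := by rcases hm with ⟨rfl, rfl⟩ | ⟨rfl, rfl⟩ <;> rfl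
          subst this
          simp at hn
        · exact ih (List.nodup_cons.1 hn).2 hm
  exact hl _ h1 he.1

theorem deg_pathEdges_le_two {l : List V} (h : l.Nodup) (x : V) : deg (pathEdges l) x ≤ 2 := by
  by_cases hx : x ∈ l
  · obtain ⟨l₁, l₂, rfl⟩ := List.append_of_mem hx
    rw [deg_pathEdges h]
    split_ifs <;> simp
  · have : deg (pathEdges l) x = 0 := by
      unfold deg
      rw [Finset.card_eq_zero, Finset.filter_eq_empty_iff]
      exact fun e he hm => hx (mem_of_mem_pathEdges he hm)
    omega

/-- Every edge of `F` that meets the list `l` is an edge of the path `l`; so the path `l` is a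
union of components of `F`, linked by further edges. -/
def Tight (F : Finset (Sym2 V)) (l : List V) : Prop :=
  ∀ e ∈ F, ∀ v ∈ l, v ∈ e → e ∈ pathEdges l

theorem Tight.deg_le {F : Finset (Sym2 V)} {l : List V} (h : Tight F l) {v : V} (hv : v ∈ l) :
    deg F v ≤ deg (pathEdges l) v := by
  unfold deg
  refine Finset.card_le_card fun e he => ?_
  rw [Finset.mem_filter] at he ⊢
  exact ⟨h e he.1 v hv he.2, he.2⟩

theorem Tight.reverse {F : Finset (Sym2 V)} {l : List V} (h : Tight F l) : Tight F l.reverse := by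
  intro e he v hv hve
  rw [pathEdges_reverse]
  exact h e he v (List.mem_reverse.1 hv) hve

/-- `F` is the edge set of a disjoint union of paths. Acyclicity is expressed by asking for a
vertex of degree at most one in every nonempty union of components. -/
structure IsLinearForest (F : Finset (Sym2 V)) : Prop where
  loopless : ∀ e ∈ F, ¬ e.IsDiag
  deg_le_two : ∀ v, deg F v ≤ 2
  exists_end : ∀ Y : Set V, Y.Nonempty → (∀ x ∈ Y, ∀ y, s(x, y) ∈ F → y ∈ Y) →
    ∃ v ∈ Y, deg F v ≤ 1

theorem isLinearForest_empty : IsLinearForest (∅ : Finset (Sym2 V)) where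
  loopless := by simp
  deg_le_two := by simp [deg]
  exists_end := fun Y ⟨v, hv⟩ _ => ⟨v, hv, by simp [deg]⟩

/-- The component of an end of a linear forest, listed from that end. -/
theorem IsLinearForest.exists_component [Fintype V] {F : Finset (Sym2 V)} (hF : IsLinearForest F)
    {u : V} (hu : deg F u ≤ 1) :
    ∃ c : List V, (u :: c).Nodup ∧ pathEdges (u :: c) ⊆ F ∧ Tight F (u :: c) := by
  -- a longest path of `F` that starts at `u`
  let P : ℕ → Prop := fun k => ∃ c : List V, c.length = k ∧ (u :: c).Nodup ∧ pathEdges (u :: c) ⊆ F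
  have hP0 : P 0 := ⟨[], by simp⟩
  have hb : ∀ k, P k → k ≤ Fintype.card V := by
    rintro k ⟨c, rfl, hn, -⟩
    exact (List.nodup_cons.1 hn).2.length_le_card
  classical
  obtain ⟨c, hc, hn, hF'⟩ := Nat.findGreatest_spec (P := P) (Nat.zero_le (Fintype.card V)) hP0
  refine ⟨c, hn, hF', ?_⟩
  have hmax : ∀ c' : List V, (u :: c').Nodup → pathEdges (u :: c') ⊆ F → c'.length ≤ c.length := by
    intro c' h1 h2
    rw [hc]
    exact Nat.le_findGreatest (hb _ ⟨c', rfl, h1, h2⟩) ⟨c', rfl, h1, h2⟩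
  have hdeg : ∀ v, deg (pathEdges (u :: c)) v ≤ deg F v := fun v => deg_mono hF' v
  have hlast : ∀ l x z, u :: c = l ++ [x] → s(x, z) ∈ F → z ∈ u :: c := by
    intro l x z hl hxz
    by_contra hz
    have h1 : u :: (c ++ [z]) = l ++ x :: z :: [] := by
      rw [← List.cons_append, hl]; simp
    have := hmax (c ++ [z]) ?_ ?_
    · simp at this
    · rw [← List.cons_append]
      rw [List.nodup_append]
      refine ⟨hn, by simp, ?_⟩
      intro a ha b hb hab
      simp only [List.mem_singleton] at hb
      subst hb; subst hab; exact hz ha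
    · rw [h1, pathEdges_append_cons_cons, ← hl]
      intro e he
      simp only [Finset.mem_insert, Finset.mem_union, pathEdges_singleton,
        Finset.notMem_empty, or_false] at he
      rcases he with rfl | he
      · exact hxz
      · exact hF' he
  -- a vertex of the path whose degree in `F` is not used up is the last one
  intro e he v hv hve
  by_contra hnot
  have hlt : ∀ w ∈ e, w ∈ u :: c → deg (pathEdges (u :: c)) w < deg F w := by
    intro w hw _
    refine Finset.card_lt_card ⟨Finset.filter_subset_filter _ hF', fun h => ?_⟩
    exact hnot (Finset.mem_filter.1 (h (Finset.mem_filter.2 ⟨he, hw⟩))).1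
  have hend : ∀ w ∈ e, w ∈ u :: c → ∃ l, u :: c = l ++ [w] := by
    intro w hw hwc
    have h3 := hlt w hw hwc
    obtain ⟨l₁, l₂, hl⟩ := List.append_of_mem hwc
    rw [hl] at h3 hn
    rw [deg_pathEdges hn] at h3
    have h4 := hF.deg_le_two w
    rcases l₂ with _ | ⟨y, l₂⟩
    · exact ⟨l₁, hl⟩
    · exfalso
      rcases l₁ with _ | ⟨x, l₁⟩
      · simp at hl
        rw [← hl.1] at h3
        simp at h3
        omega
      · simp at h3; omega
  obtain ⟨z, rfl⟩ := Sym2.mem_iff_exists.1 hve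
  obtain ⟨l, hl⟩ := hend v hve hv
  have hz := hlast l v z hl he
  obtain ⟨l', hl'⟩ := hend z (by simp) hz
  rw [hl] at hl'
  have hvz : v = z := by
    have := congrArg List.getLast? hl'
    simpa using this
  subst hvz
  exact hF.loopless _ he (by simp)

/-- A vertex of degree at most one in a component is one of the two ends of that component. -/
theorem eq_head_or_getLast {F : Finset (Sym2 V)} {u w : V} {c : List V} (hn : (u :: c).Nodup)
    (hF : pathEdges (u :: c) ⊆ F) (hw : w ∈ u :: c) (hd : deg F w ≤ 1) :
    w = u ∨ (u :: c).getLast? = some w := by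
  obtain ⟨l₁, l₂, hl⟩ := List.append_of_mem hw
  have h := deg_mono hF w
  rw [hl] at hn h
  rw [deg_pathEdges hn] at h
  rcases l₁ with _ | ⟨x, l₁⟩
  · simp at hl; exact .inl hl.1.symm
  · rcases l₂ with _ | ⟨y, l₂⟩
    · right; rw [hl]; exact List.getLast?_concat
    · simp at h; omega

/-- Joining an end `v` of a linear forest to a vertex `x` outside the component of `v` leaves a
linear forest. -/
theorem IsLinearForest.insert_edge {F : Finset (Sym2 V)} (hF : IsLinearForest F)
    {v x : V} {c : List V} (hn : (v :: c).Nodup) (hcF : pathEdges (v :: c) ⊆ F)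
    (ht : Tight F (v :: c)) (hx : x ∉ v :: c) (hv : deg F v ≤ 1) (hxd : deg F x ≤ 1) :
    IsLinearForest (insert s(v, x) F) := by
  have hvx : s(v, x) ∉ F := fun h =>
    hx (mem_of_mem_pathEdges (ht _ h v (by simp) (by simp)) (by simp))
  refine ⟨?_, ?_, ?_⟩
  · intro e he
    rw [Finset.mem_insert] at he
    rcases he with rfl | he
    · intro h
      rw [Sym2.mk_isDiag_iff] at h
      subst h; simp at hx
    · exact hF.loopless e he
  · intro z
    rw [deg_insert hvx]
    split_ifs with h
    · rw [Sym2.mem_iff] at h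
      rcases h with rfl | rfl <;> omega
    · exact hF.deg_le_two z
  · intro Y hY hcl
    by_contra hcon
    push Not at hcon
    have hclF : ∀ a ∈ Y, ∀ b, s(a, b) ∈ F → b ∈ Y := fun a ha b hab =>
      hcl a ha b (Finset.mem_insert_of_mem hab)
    obtain ⟨w, hwY, hw⟩ := hF.exists_end Y hY hclF
    have hw2 := hcon w hwY
    have hvY : v ∈ Y := by
      rw [deg_insert hvx] at hw2
      by_cases hwe : w ∈ s(v, x)
      · rw [Sym2.mem_iff] at hwe
        rcases hwe with rfl | rfl
        · exact hwY
        · exact hcl w hwY v (by rw [Sym2.eq_swap]; simp)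
      · rw [if_neg hwe] at hw2; omega
    -- follow the component of `v` to its other end
    have hall : ∀ l : List V, ∀ a, pathEdges (a :: l) ⊆ F → a ∈ Y → ∀ b ∈ a :: l, b ∈ Y := by
      intro l
      induction l with
      | nil => intro a _ ha b hb; simp at hb; subst hb; exact ha
      | cons y l ih =>
        intro a hl ha b hb
        rw [pathEdges_cons_cons, Finset.insert_subset_iff] at hl
        rw [List.mem_cons] at hb
        rcases hb with rfl | hb
        · exact ha
        · exact ih y hl.2 (hclF a ha y hl.1) b hb
    have hcY := hall c v hcF hvY
    rcases List.eq_nil_or_concat' c with rfl | ⟨l, z, rfl⟩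
    · have h1 := ht.deg_le (v := v) (by simp)
      have h2 := hcon v hvY
      rw [deg_insert hvx] at h2
      rw [deg_pathEdges_head hn, if_pos rfl] at h1
      split_ifs at h2 <;> omega
    · have hz : z ∈ v :: (l ++ [z]) := by simp
      have h1 := ht.deg_le hz
      have h2 := hcon z (hcY z hz)
      rw [deg_insert hvx] at h2
      rw [show v :: (l ++ [z]) = (v :: l) ++ [z] by simp] at hn h1
      rw [deg_pathEdges_last hn] at h1
      have hzv : z ≠ v := by
        rintro rfl; simp at hn
      have hzx : z ≠ x := by
        rintro rfl; exact hx hz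
      rw [if_neg (by rw [Sym2.mem_iff]; tauto)] at h2
      simp at h1
      omega

/-- Deleting an edge of a linear forest leaves a linear forest. -/
theorem IsLinearForest.erase_edge {F : Finset (Sym2 V)} (hF : IsLinearForest F) {e : Sym2 V}
    (he : e ∈ F) : IsLinearForest (F.erase e) := by
  have hle : ∀ z, deg (F.erase e) z ≤ deg F z := fun z => deg_mono (Finset.erase_subset _ _) z
  refine ⟨fun f hf => hF.loopless f (Finset.mem_of_mem_erase hf),
    fun v => (hle v).trans (hF.deg_le_two v), ?_⟩
  intro Y hY hcl
  by_contra hcon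
  push Not at hcon
  have hnot : ∀ z ∈ Y, z ∉ e := by
    intro z hz hze
    have h1 := deg_erase he z
    rw [if_pos hze] at h1
    have := hcon z hz
    have := hF.deg_le_two z
    omega
  obtain ⟨w, hw, hd⟩ := hF.exists_end Y hY (fun a ha b hab => hcl a ha b (by
    rw [Finset.mem_erase]
    refine ⟨?_, hab⟩
    rintro rfl
    exact hnot a ha (by simp)))
  have := hcon w hw
  have := hle w
  omega

end Paths

/-! ### Pósa rotations -/

section Rotations

variable {V : Type*} [Fintype V] [DecidableEq V]

theorem exists_walk_of_list {M : Finset (Sym2 V)} (l : List V) (x : V) (hn : (x :: l).Nodup)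
    (hM : pathEdges (x :: l) ⊆ M) :
    ∃ (y : V) (p : (SimpleGraph.fromEdgeSet (M : Set (Sym2 V))).Walk x y),
      (x :: l).getLast? = some y ∧ p.support = x :: l ∧ ∀ e ∈ p.edges, e ∈ pathEdges (x :: l) := by
  induction l generalizing x with
  | nil => exact ⟨x, .nil, by simp⟩
  | cons z l ih =>
    rw [pathEdges_cons_cons, Finset.insert_subset_iff] at hM
    obtain ⟨y, p, h1, h2, h3⟩ := ih z (List.nodup_cons.1 hn).2 hM.2
    have hadj : (SimpleGraph.fromEdgeSet (M : Set (Sym2 V))).Adj x z := by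
      rw [SimpleGraph.fromEdgeSet_adj]
      refine ⟨hM.1, ?_⟩
      rintro rfl
      simp at hn
    refine ⟨y, .cons hadj p, by rw [List.getLast?_cons_cons]; exact h1, by simp [h2], ?_⟩
    intro e he
    rw [SimpleGraph.Walk.edges_cons, List.mem_cons] at he
    rw [pathEdges_cons_cons, Finset.mem_insert]
    exact he.imp id (h3 e)

/-- A spanning path together with an edge that joins its two ends is a Hamilton cycle. -/
theorem hasHamiltonCycle_of_list {M : Finset (Sym2 V)} {l : List V} {x y : V} (hn : l.Nodup)
    (hall : ∀ v, v ∈ l) (h3 : 3 ≤ l.length) (hM : pathEdges l ⊆ M) (hx : l.head? = some x)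
    (hy : l.getLast? = some y) (hxy : s(x, y) ∈ M) : HasHamiltonCycle M := by
  rcases l with _ | ⟨a, _ | ⟨c, t⟩⟩
  · simp at h3
  · simp at h3
  simp only [List.head?_cons, Option.some.injEq] at hx
  subst hx
  obtain ⟨z, p, h1, h2, h4⟩ := exists_walk_of_list _ _ hn hM
  rw [h1, Option.some.injEq] at hy
  subst hy
  have ht : t ≠ [] := by rintro rfl; simp at h3
  have hzt : z ∈ t := by
    rw [List.getLast?_cons_cons, List.getLast?_cons, Option.some.injEq,
      List.getLast?_eq_getLast_of_ne_nil ht] at h1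
    rw [← h1]; simp
  have haz : z ≠ a := by
    rintro rfl
    simp [hzt] at hn
  have hcz : z ≠ c := by
    rintro rfl
    simp [hzt] at hn
  have hadj : (SimpleGraph.fromEdgeSet (M : Set (Sym2 V))).Adj z a := by
    rw [SimpleGraph.fromEdgeSet_adj]
    exact ⟨by rw [Sym2.eq_swap]; exact hxy, haz⟩
  refine ⟨z, .cons hadj p, ?_⟩
  rw [SimpleGraph.Walk.isHamiltonianCycle_iff_isCycle_and_support_count_tail_eq_one]
  constructor
  · rw [SimpleGraph.Walk.cons_isCycle_iff]
    refine ⟨?_, ?_⟩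
    · rw [SimpleGraph.Walk.isPath_def, h2]; exact hn
    · intro he
      have h5 := h4 _ he
      have h6 := deg_pathEdges_head hn
      have h7 := two_le_deg (v := a) h5 (f := s(a, c)) (by simp) (by simp) (by simp) (by
        intro h
        rw [Sym2.eq_iff] at h
        rcases h with ⟨h, -⟩ | ⟨h, -⟩
        · exact haz h
        · exact hcz h)
      rw [if_neg (by simp)] at h6
      omega
  · intro v
    rw [SimpleGraph.Walk.support_cons, List.tail_cons, h2]
    exact List.count_eq_one_of_mem hn (hall v)

/-- The linear forest `F` spans everything outside the core `W` with inner vertices of its paths,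
which end in `W`, and leaves the pivots `P ⊆ W` untouched. -/
structure IsAttached (F : Finset (Sym2 V)) (W P : Finset V) : Prop where
  forest : IsLinearForest F
  subset : P ⊆ W
  deg_pivot : ∀ x ∈ P, deg F x = 0
  deg_core : ∀ x ∈ W, deg F x ≤ 1
  deg_outside : ∀ x, x ∉ W → deg F x = 2

/-- Small subsets of `W` expand into `P`, and large ones are joined to every large subset
of `P`. -/
structure IsExpander (M : Finset (Sym2 V)) (W P : Finset V) (a : ℕ) : Prop where
  small : ∀ X ⊆ W, X.Nonempty → X.card ≤ a →
    3 * X.card ≤ (P.filter fun x => x ∉ X ∧ ∃ y ∈ X, s(y, x) ∈ M).card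
  large : ∀ A ⊆ W, ∀ B ⊆ P, Disjoint A B → a ≤ A.card → a ≤ B.card →
    ∃ x ∈ A, ∃ y ∈ B, s(x, y) ∈ M

theorem IsExpander.mono {M M' : Finset (Sym2 V)} {W P : Finset V} {a : ℕ}
    (h : IsExpander M W P a) (hM : M ⊆ M') : IsExpander M' W P a where
  small := fun X hX hne hc => (h.small X hX hne hc).trans <| Finset.card_le_card fun x hx => by
    rw [Finset.mem_filter] at hx ⊢
    obtain ⟨h1, h2, y, hy, hyx⟩ := hx
    exact ⟨h1, h2, y, hy, hM hyx⟩
  large := fun A hA B hB hd ha hb => by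
    obtain ⟨x, hx, y, hy, hxy⟩ := h.large A hA B hB hd ha hb
    exact ⟨x, hx, y, hy, hM hxy⟩

/-- A path of Maker's graph with both ends in the core, made up of core vertices and entire
components of the linear forest. -/
structure GoodPath (M F : Finset (Sym2 V)) (W : Finset V) (l : List V) : Prop where
  nodup : l.Nodup
  edges : pathEdges l ⊆ M
  tight : Tight F l
  head : ∀ x, l.head? = some x → x ∈ W
  last : ∀ x, l.getLast? = some x → x ∈ W

variable {M F : Finset (Sym2 V)} {W P : Finset V}

theorem GoodPath.mono {M' : Finset (Sym2 V)} {l : List V} (h : GoodPath M F W l) (hM : M ⊆ M') :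
    GoodPath M' F W l :=
  ⟨h.nodup, h.edges.trans hM, h.tight, h.head, h.last⟩

theorem GoodPath.reverse {l : List V} (h : GoodPath M F W l) : GoodPath M F W l.reverse where
  nodup := List.nodup_reverse.2 h.nodup
  edges := by rw [pathEdges_reverse]; exact h.edges
  tight := h.tight.reverse
  head := fun x hx => h.last x (by rwa [List.head?_reverse] at hx)
  last := fun x hx => h.head x (by rwa [List.getLast?_reverse] at hx)

theorem not_mem_of_deg_eq_zero {x : V} {e : Sym2 V} (h : deg F x = 0) (he : e ∈ F) : x ∉ e :=
  fun hx => (deg_pos he hx).ne' h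

/-- The path neighbours of a pivot lie in the core. -/
theorem GoodPath.mem_core {l : List V} (h : GoodPath M F W l) (hF : IsAttached F W P) {x z : V}
    (hx : x ∈ P) (hxz : s(x, z) ∈ pathEdges l) : z ∈ W := by
  by_contra hz
  have h2 := hF.deg_outside z hz
  have hzl : z ∈ l := mem_of_mem_pathEdges hxz (by simp)
  have hsub : F.filter (z ∈ ·) ⊆ (pathEdges l).filter (z ∈ ·) := by
    intro e he
    rw [Finset.mem_filter] at he ⊢
    exact ⟨h.tight e he.1 z hzl he.2, he.2⟩
  have heq := Finset.eq_of_subset_of_card_le hsub (by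
    have := deg_pathEdges_le_two h.nodup z
    unfold deg at this h2
    omega)
  have : s(x, z) ∈ F.filter (z ∈ ·) := by
    rw [heq, Finset.mem_filter]
    exact ⟨hxz, by simp⟩
  exact not_mem_of_deg_eq_zero (hF.deg_pivot x hx) (Finset.mem_filter.1 this).1 (by simp)

theorem goodPath_singleton (hF : IsAttached F W P) {x : V} (hx : x ∈ P) : GoodPath M F W [x] where
  nodup := by simp
  edges := by simp
  tight := fun e he v hv hve => by
    rw [List.mem_singleton] at hv
    subst hv
    exact absurd hve (not_mem_of_deg_eq_zero (hF.deg_pivot v hx) he)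
  head := fun y hy => by simp at hy; subst hy; exact hF.subset hx
  last := fun y hy => by simp at hy; subst hy; exact hF.subset hx

/-- The part of a good path after a pivot may be reversed if its last vertex is joined to the
pivot. -/
theorem GoodPath.rotate {l₁ t : List V} {x r : V} (h : GoodPath M F W (l₁ ++ x :: t))
    (hF : IsAttached F W P) (hx : x ∈ P) (hr : t.getLast? = some r) (hxr : s(x, r) ∈ M) :
    GoodPath M F W (l₁ ++ x :: t.reverse) := by
  have hperm : (l₁ ++ x :: t.reverse).Perm (l₁ ++ x :: t) :=
    List.Perm.append_left _ ((List.reverse_perm t).cons x)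
  rcases t with _ | ⟨y, t⟩
  · simp at hr
  obtain ⟨t', ht'⟩ : ∃ t', (y :: t).reverse = r :: t' := by
    rw [← List.head?_reverse] at hr
    exact ⟨_, List.eq_cons_of_mem_head? hr⟩
  have hedges : pathEdges (l₁ ++ x :: (y :: t).reverse) =
      insert s(x, r) (pathEdges (l₁ ++ [x]) ∪ pathEdges (y :: t)) := by
    rw [ht', pathEdges_append_cons_cons, ← ht', pathEdges_reverse]
  have hold := pathEdges_append_cons_cons l₁ x y t
  have hE := h.edges
  rw [hold, Finset.insert_subset_iff] at hE
  refine ⟨hperm.nodup_iff.2 h.nodup, ?_, ?_, ?_, ?_⟩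
  · rw [hedges, Finset.insert_subset_iff]
    exact ⟨hxr, hE.2⟩
  · intro e he v hv hve
    have h1 := h.tight e he v (hperm.mem_iff.1 hv) hve
    rw [hold, Finset.mem_insert] at h1
    rw [hedges, Finset.mem_insert]
    refine .inr (h1.resolve_left ?_)
    rintro rfl
    exact not_mem_of_deg_eq_zero (hF.deg_pivot x hx) he (by simp)
  · intro z hz
    apply h.head z
    rcases l₁ with _ | ⟨w, l₁⟩
    · simpa using hz
    · simpa using hz
  · intro z hz
    have hz' : z = y := by
      have h1 : l₁ ++ x :: (y :: t).reverse = (l₁ ++ x :: t.reverse) ++ [y] := by simp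
      rw [h1, List.getLast?_concat] at hz
      exact (Option.some.inj hz).symm
    subst hz'
    exact h.mem_core hF hx (by rw [hold]; simp)

/-- A good path is prolonged by a whole component of the forest. -/
theorem GoodPath.extend {l : List V} {x y : V} (h : GoodPath M F W (l ++ [x]))
    (hF : IsAttached F W P) (hFM : F ⊆ M) (hy : y ∈ W) (hyl : y ∉ l ++ [x]) (hxy : s(x, y) ∈ M) :
    ∃ c, GoodPath M F W (l ++ [x] ++ y :: c) := by
  obtain ⟨c, hn, hcF, ht⟩ := hF.forest.exists_component (hF.deg_core y hy)
  refine ⟨c, ?_⟩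
  have hdis : ∀ (d : List V) (z : V), pathEdges (z :: d) ⊆ F → z ∉ l ++ [x] →
      ∀ w ∈ z :: d, w ∉ l ++ [x] := by
    intro d
    induction d with
    | nil => intro z _ hz w hw; simp only [List.mem_singleton] at hw; rwa [hw]
    | cons a d ih =>
      intro z hzd hz w hw
      rw [pathEdges_cons_cons, Finset.insert_subset_iff] at hzd
      rcases List.mem_cons.1 hw with rfl | hw
      · exact hz
      · refine ih a hzd.2 (fun ha => hz ?_) w hw
        exact mem_of_mem_pathEdges (h.tight _ hzd.1 a ha (by simp)) (Sym2.mem_mk_left z a)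
  have hdis := hdis c y hcF hyl
  have hedges : pathEdges (l ++ [x] ++ y :: c) =
      insert s(x, y) (pathEdges (l ++ [x]) ∪ pathEdges (y :: c)) := by
    rw [List.append_assoc, List.singleton_append, pathEdges_append_cons_cons]
  refine ⟨?_, ?_, ?_, ?_, ?_⟩
  · rw [List.nodup_append]
    refine ⟨h.nodup, hn, ?_⟩
    rintro v hv w hw rfl
    exact hdis v hw hv
  · rw [hedges, Finset.insert_subset_iff, Finset.union_subset_iff]
    exact ⟨hxy, h.edges, hcF.trans hFM⟩
  · intro e he v hv hve
    rw [hedges, Finset.mem_insert, Finset.mem_union]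
    rcases List.mem_append.1 hv with hv | hv
    · exact .inr (.inl (h.tight e he v hv hve))
    · exact .inr (.inr (ht e he v hv hve))
  · intro z hz
    apply h.head z
    rw [List.head?_append] at hz
    rcases l with _ | ⟨a, l⟩
    · simpa using hz
    · simpa using hz
  · intro z hz
    by_contra hzW
    have h2 := hF.deg_outside z hzW
    rcases List.eq_nil_or_concat' c with rfl | ⟨d, w, rfl⟩
    · rw [List.getLast?_concat] at hz
      rw [← Option.some.inj hz] at hzW
      exact hzW hy
    · rw [show l ++ [x] ++ y :: (d ++ [w]) = (l ++ [x] ++ y :: d) ++ [w] by simp,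
        List.getLast?_concat] at hz
      have := Option.some.inj hz
      subst this
      have h3 := ht.deg_le (v := w) (by simp)
      rw [show y :: (d ++ [w]) = (y :: d) ++ [w] by simp] at hn h3
      rw [deg_pathEdges_last hn] at h3
      simp at h3
      omega

/-- The paths obtained from `Q` by Pósa rotations at pivots, with the first vertex kept fixed. -/
inductive Rotation (M : Finset (Sym2 V)) (P : Finset V) (Q : List V) : List V → Prop
  | refl : Rotation M P Q Q
  | step {l₁ t : List V} {x r : V} : Rotation M P Q (l₁ ++ x :: t) → x ∈ P →
      t.getLast? = some r → s(x, r) ∈ M → Rotation M P Q (l₁ ++ x :: t.reverse)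

theorem Rotation.goodPath {Q l : List V} (h : Rotation M P Q l) (hF : IsAttached F W P)
    (hQ : GoodPath M F W Q) : GoodPath M F W l := by
  induction h with
  | refl => exact hQ
  | step _ hx hr hxr ih => exact ih.rotate hF hx hr hxr

theorem Rotation.perm {Q l : List V} (h : Rotation M P Q l) : l.Perm Q := by
  induction h with
  | refl => exact .refl _
  | step _ _ _ _ ih => exact (List.Perm.append_left _ ((List.reverse_perm _).cons _)).trans ih

theorem Rotation.head? {Q l : List V} (h : Rotation M P Q l) : l.head? = Q.head? := by
  induction h with
  | refl => rfl
  | @step l₁ t x r _ _ _ _ ih =>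
    rw [← ih]
    cases l₁ <;> simp

open Classical in
/-- The last vertices of the rotations of `Q`. -/
noncomputable def rotationEnds (M : Finset (Sym2 V)) (P : Finset V) (Q : List V) : Finset V :=
  Finset.univ.filter fun r => ∃ l, Rotation M P Q l ∧ l.getLast? = some r

theorem mem_rotationEnds {Q : List V} {r : V} :
    r ∈ rotationEnds M P Q ↔ ∃ l, Rotation M P Q l ∧ l.getLast? = some r := by
  simp [rotationEnds]

/-- A rotation only breaks edges at a vertex that becomes an end. -/
theorem Rotation.mem_pathEdges {Q l : List V} (h : Rotation M P Q l) {e : Sym2 V}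
    (he : e ∈ pathEdges Q) (hR : ∀ v ∈ e, v ∉ rotationEnds M P Q) : e ∈ pathEdges l := by
  induction h with
  | refl => exact he
  | @step l₁ t x r hrot hx hr hxr ih =>
    rcases t with _ | ⟨y, t⟩
    · simp at hr
    have hy : y ∈ rotationEnds M P Q := by
      rw [mem_rotationEnds]
      refine ⟨_, hrot.step hx hr hxr, ?_⟩
      rw [show l₁ ++ x :: (y :: t).reverse = (l₁ ++ x :: t.reverse) ++ [y] by simp,
        List.getLast?_concat]
    rw [pathEdges_append_cons_cons, Finset.mem_insert, Finset.mem_union] at ih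
    rw [pathEdges_append_cons, Finset.mem_union]
    rcases ih with rfl | ih | ih
    · exact absurd hy (hR y (by simp))
    · exact .inl ih
    · right
      obtain ⟨t', ht'⟩ : ∃ t', (y :: t).reverse = r :: t' := by
        rw [← List.head?_reverse] at hr
        exact ⟨_, List.eq_cons_of_mem_head? hr⟩
      rw [ht', pathEdges_cons_cons, ← ht', pathEdges_reverse]
      exact Finset.mem_insert_of_mem ih

/-- Pósa's lemma: a pivot joined to an end is itself an end, or is next to one on `Q`. -/
theorem exists_adjacent_end {Q : List V} (hQ : Q.Nodup) {r x : V} (hr : r ∈ rotationEnds M P Q)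
    (hx : x ∈ P) (hxQ : x ∈ Q) (hrx : s(r, x) ∈ M) (hxR : x ∉ rotationEnds M P Q) :
    ∃ y ∈ rotationEnds M P Q, s(y, x) ∈ pathEdges Q := by
  by_contra hcon
  push Not at hcon
  obtain ⟨l, hl, hlr⟩ := mem_rotationEnds.1 hr
  have hln : l.Nodup := hl.perm.nodup_iff.2 hQ
  obtain ⟨l₁, t, rfl⟩ := List.append_of_mem (hl.perm.mem_iff.2 hxQ)
  rcases t with _ | ⟨y, t⟩
  · exact hxR (mem_rotationEnds.2 ⟨_, hl, List.getLast?_concat⟩)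
  have htr : (y :: t).getLast? = some r := by
    rw [List.getLast?_append, List.getLast?_cons_cons] at hlr
    rw [List.getLast?_cons] at hlr ⊢
    simpa using hlr
  have hy : y ∈ rotationEnds M P Q := by
    rw [mem_rotationEnds]
    refine ⟨_, hl.step hx htr (by rw [Sym2.eq_swap]; exact hrx), ?_⟩
    rw [show l₁ ++ x :: (y :: t).reverse = (l₁ ++ x :: t.reverse) ++ [y] by simp,
      List.getLast?_concat]
  -- no path edge at `x` gets broken, and the rotated path has an additional edge `xy` at `x`
  have hlt : deg (pathEdges Q) x < deg (pathEdges (l₁ ++ x :: y :: t)) x := by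
    refine Finset.card_lt_card ⟨fun e he => ?_, fun hsub => ?_⟩
    · rw [Finset.mem_filter] at he ⊢
      refine ⟨hl.mem_pathEdges he.1 ?_, he.2⟩
      obtain ⟨z, rfl⟩ := Sym2.mem_iff_exists.1 he.2
      intro v hv
      rw [Sym2.mem_iff] at hv
      rcases hv with rfl | rfl
      · exact hxR
      · intro hz
        exact hcon _ hz (by rw [Sym2.eq_swap]; exact he.1)
    · have h1 : s(x, y) ∈ (pathEdges (l₁ ++ x :: y :: t)).filter (x ∈ ·) := by
        rw [Finset.mem_filter, pathEdges_append_cons_cons]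
        simp
      have h2 := (Finset.mem_filter.1 (hsub h1)).1
      exact hcon y hy (by rw [Sym2.eq_swap]; exact h2)
  rw [deg_pathEdges hln] at hlt
  obtain ⟨q₁, q₂, rfl⟩ := List.append_of_mem hxQ
  rw [deg_pathEdges hQ] at hlt
  have hq₂ : q₂ ≠ [] := by
    rintro rfl
    exact hxR (mem_rotationEnds.2 ⟨_, .refl, List.getLast?_concat⟩)
  have hhead := hl.head?
  rcases q₁ with _ | ⟨w, q₁⟩
  · rcases l₁ with _ | ⟨z, l₁⟩
    · simp [hq₂] at hlt
    · simp at hhead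
      subst hhead
      simp at hln
  · simp [hq₂] at hlt
    split_ifs at hlt <;> omega

end Rotations

/-! ### Boosters -/

section Boosters

variable {V : Type*} [Fintype V] [DecidableEq V] {M F : Finset (Sym2 V)} {W P : Finset V} {a : ℕ}

theorem rotationEnds_subset (hF : IsAttached F W P) {Q : List V} (hQ : GoodPath M F W Q) :
    rotationEnds M P Q ⊆ W := fun r hr => by
  obtain ⟨l, hl, hlr⟩ := mem_rotationEnds.1 hr
  exact (hl.goodPath hF hQ).last r hlr

theorem mem_of_mem_rotationEnds {Q : List V} {r : V} (hr : r ∈ rotationEnds M P Q) : r ∈ Q := by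
  obtain ⟨l, hl, hlr⟩ := mem_rotationEnds.1 hr
  exact hl.perm.mem_iff.1 (List.mem_of_getLast? hlr)

/-- Expansion forces a path that no end can leave to have many ends. -/
theorem lt_card_rotationEnds (hF : IsAttached F W P) (hE : IsExpander M W P a) {Q : List V}
    (hQ : GoodPath M F W Q) (hne : Q ≠ [])
    (hmax : ∀ r ∈ rotationEnds M P Q, ∀ x ∈ P, s(r, x) ∈ M → x ∈ Q) :
    a < (rotationEnds M P Q).card := by
  by_contra hle
  push Not at hle
  set R := rotationEnds M P Q with hR
  have hRne : R.Nonempty :=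
    ⟨Q.getLast hne, mem_rotationEnds.2 ⟨Q, .refl, List.getLast?_eq_getLast_of_ne_nil hne⟩⟩
  have h1 := hE.small R (rotationEnds_subset hF hQ) hRne hle
  have h2 : (P.filter fun x => x ∉ R ∧ ∃ y ∈ R, s(y, x) ∈ M) ⊆
      R.biUnion fun y => Finset.univ.filter fun x => s(y, x) ∈ pathEdges Q := by
    intro x hx
    rw [Finset.mem_filter] at hx
    obtain ⟨hxP, hxR, r, hr, hrx⟩ := hx
    obtain ⟨y, hy, hyx⟩ := exists_adjacent_end hQ.nodup hr hxP (hmax r hr x hxP hrx) hrx hxR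
    rw [Finset.mem_biUnion]
    exact ⟨y, hy, by simpa using hyx⟩
  have h3 := Finset.card_le_card h2
  have h4 := Finset.card_biUnion_le_card_mul R
    (fun y => Finset.univ.filter fun x => s(y, x) ∈ pathEdges Q) 2
    (fun y _ => (card_neighbors_le _ y).trans (deg_pathEdges_le_two hQ.nodup y))
  have h5 := hRne.card_pos
  omega

/-- The number of core vertices on a list. -/
def coreCount (W : Finset V) (l : List V) : ℕ := (W.filter (· ∈ l)).card

theorem coreCount_congr {l l' : List V} (h : l.Perm l') : coreCount W l = coreCount W l' := by
  unfold coreCount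
  congr 1
  ext x
  simp [h.mem_iff]

theorem coreCount_lt_append {l l' : List V} {y : V} (hy : y ∈ W) (hyl : y ∉ l) (hyl' : y ∈ l') :
    coreCount W l < coreCount W (l ++ l') := by
  refine Finset.card_lt_card ⟨fun x hx => ?_, fun h => ?_⟩
  · rw [Finset.mem_filter] at hx ⊢
    exact ⟨hx.1, List.mem_append_left _ hx.2⟩
  · exact hyl (Finset.mem_filter.1
      (h (Finset.mem_filter.2 ⟨hy, List.mem_append_right l hyl'⟩))).2

/-- If some core vertex is missing on a path with many ends, then a missing core vertex is joined
to a pivot on the path. -/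
theorem exists_missing_adjacent (hE : IsExpander M W P a) (hPW : P ⊆ W) (ha : 1 ≤ a) {Q : List V}
    {R : Finset V} (hRW : R ⊆ W) (hRQ : ∀ r ∈ R, r ∈ Q) (hRa : a ≤ R.card)
    (hmax : ∀ r ∈ R, ∀ x ∈ P, s(r, x) ∈ M → x ∈ Q) (hmiss : ∃ y ∈ W, y ∉ Q) :
    ∃ y ∈ W, y ∉ Q ∧ ∃ x ∈ P, x ∈ Q ∧ s(x, y) ∈ M := by
  set Y := P.filter (· ∉ Q) with hY
  have hYa : Y.card < a := by
    by_contra hle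
    push Not at hle
    obtain ⟨r, hr, y, hy, hry⟩ := hE.large R hRW Y (Finset.filter_subset _ _) (by
      rw [Finset.disjoint_left]
      intro x hx hx'
      exact (Finset.mem_filter.1 hx').2 (hRQ x hx)) hRa hle
    rw [hY, Finset.mem_filter] at hy
    exact hy.2 (hmax r hr y hy.1 hry)
  rcases Y.eq_empty_or_nonempty with h0 | hne
  · obtain ⟨y, hyW, hyQ⟩ := hmiss
    have h1 := hE.small {y} (by simpa using hyW) (by simp) (by simpa using ha)
    obtain ⟨x, hx⟩ := Finset.card_pos.1 (lt_of_lt_of_le (by simp) h1)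
    rw [Finset.mem_filter] at hx
    obtain ⟨hxP, -, z, hz, hzx⟩ := hx
    rw [Finset.mem_singleton] at hz
    subst hz
    refine ⟨z, hyW, hyQ, x, hxP, ?_, by rw [Sym2.eq_swap]; exact hzx⟩
    by_contra hxQ
    have : x ∈ Y := by rw [hY, Finset.mem_filter]; exact ⟨hxP, hxQ⟩
    rw [h0] at this
    simp at this
  · have h1 := hE.small Y ((Finset.filter_subset _ _).trans hPW) hne hYa.le
    obtain ⟨x, hx⟩ := Finset.card_pos.1 (lt_of_lt_of_le (by have := hne.card_pos; omega) h1)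
    rw [Finset.mem_filter] at hx
    obtain ⟨hxP, hxY, y, hy, hyx⟩ := hx
    rw [hY, Finset.mem_filter] at hy hxY
    refine ⟨y, hPW hy.1, hy.2, x, hxP, ?_, by rw [Sym2.eq_swap]; exact hyx⟩
    by_contra hxQ
    exact hxY ⟨hxP, hxQ⟩

/-- Closing a good path to a cycle gives a Hamilton cycle, or a cycle that may be opened at a pivot
so as to absorb a further core vertex. -/
theorem GoodPath.close {l : List V} {r r' : V} (h : GoodPath M F W l) (hF : IsAttached F W P)
    (hFM : F ⊆ M) (hcard : 3 ≤ Fintype.card V) (hr : l.head? = some r) (hr' : l.getLast? = some r')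
    (hmiss : (∃ y ∈ W, y ∉ l) → ∃ y ∈ W, y ∉ l ∧ ∃ x ∈ P, x ∈ l ∧ s(x, y) ∈ M) :
    HasHamiltonCycle (insert s(r, r') M) ∨
      ∃ l', GoodPath (insert s(r, r') M) F W l' ∧ coreCount W l < coreCount W l' := by
  have hMM : M ⊆ insert s(r, r') M := Finset.subset_insert _ _
  by_cases hall : ∃ y ∈ W, y ∉ l
  · right
    obtain ⟨y, hyW, hyl, x, hxP, hxl, hxy⟩ := hmiss hall
    obtain ⟨l₁, l₂, rfl⟩ := List.append_of_mem hxl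
    -- open the cycle between `x` and its successor
    have hperm : (l₂ ++ l₁ ++ [x]).Perm (l₁ ++ x :: l₂) := by
      rw [List.append_assoc]
      exact List.perm_append_comm.trans (by simp)
    have hxr : pathEdges (l₂ ++ l₁ ++ [x]) ⊆ insert s(r, r') M ∧
        (∀ e ∈ pathEdges (l₁ ++ x :: l₂), x ∉ e → e ∈ pathEdges (l₂ ++ l₁ ++ [x])) ∧
        ∀ z, (l₂ ++ l₁ ++ [x]).head? = some z → z ∈ W := by
      rcases l₂ with _ | ⟨z, l₂⟩
      · simp only [List.nil_append]
        refine ⟨h.edges.trans hMM, fun e he _ => he, fun z hz => h.head z hz⟩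
      have hz : z ∈ W := h.mem_core hF hxP (by
        rw [pathEdges_append_cons_cons]; exact Finset.mem_insert_self _ _)
      have hsub := h.edges
      rw [pathEdges_append_cons_cons, Finset.insert_subset_iff, Finset.union_subset_iff] at hsub
      obtain ⟨d, hd⟩ : ∃ d, z :: l₂ = d ++ [r'] := by
        refine ⟨(z :: l₂).dropLast, ?_⟩
        rw [List.getLast?_append, List.getLast?_cons_cons, List.getLast?_cons] at hr'
        simp only [Option.some_or, Option.some.injEq] at hr'
        conv_lhs => rw [← List.dropLast_append_getLast (l := z :: l₂) (by simp)]
        rw [← hr', List.getLast_eq_getLastD, List.getLastD_eq_getLast?]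
      have hne1 : ∃ d', l₁ ++ [x] = r :: d' := by
        rcases l₁ with _ | ⟨w, l₁⟩
        · simp at hr; exact ⟨[], by simp [hr]⟩
        · simp at hr; exact ⟨l₁ ++ [x], by simp [hr]⟩
      obtain ⟨d', hd'⟩ := hne1
      have hE : pathEdges (z :: l₂ ++ l₁ ++ [x]) =
          insert s(r', r) (pathEdges (z :: l₂) ∪ pathEdges (l₁ ++ [x])) := by
        rw [List.append_assoc, hd', hd, List.append_assoc, List.singleton_append,
          pathEdges_append_cons_cons]
      refine ⟨?_, ?_, ?_⟩
      · rw [hE, Finset.insert_subset_iff, Finset.union_subset_iff]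
        exact ⟨by rw [Sym2.eq_swap]; exact Finset.mem_insert_self _ _,
          hsub.2.2.trans hMM, hsub.2.1.trans hMM⟩
      · intro e he hxe
        rw [pathEdges_append_cons_cons, Finset.mem_insert, Finset.mem_union] at he
        rw [hE, Finset.mem_insert, Finset.mem_union]
        rcases he with rfl | he | he
        · exact absurd (Sym2.mem_mk_left x z) hxe
        · exact .inr (.inr he)
        · exact .inr (.inl he)
      · intro w hw
        simp at hw
        exact hw ▸ hz
    have hgood : GoodPath (insert s(r, r') M) F W (l₂ ++ l₁ ++ [x]) := by
      refine ⟨hperm.nodup_iff.2 h.nodup, hxr.1, ?_, hxr.2.2, ?_⟩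
      · intro e he v hv hve
        exact hxr.2.1 e (h.tight e he v (hperm.mem_iff.1 hv) hve)
          (not_mem_of_deg_eq_zero (hF.deg_pivot x hxP) he)
      · intro z hz
        rw [List.getLast?_concat, Option.some.injEq] at hz
        exact hz ▸ hF.subset hxP
    have hyl' : y ∉ l₂ ++ l₁ ++ [x] := fun hm => hyl (hperm.mem_iff.1 hm)
    obtain ⟨c, hc⟩ := hgood.extend hF (hFM.trans hMM) hyW hyl' (hMM hxy)
    refine ⟨_, hc, ?_⟩
    rw [← coreCount_congr hperm]
    exact coreCount_lt_append hyW hyl' (by simp)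
  · left
    push Not at hall
    -- a vertex off the path would lie in a component of `F` without ends
    have hmem : ∀ v, v ∈ l := by
      by_contra hcon
      push Not at hcon
      obtain ⟨w, hw, hd⟩ := hF.forest.exists_end {v | v ∉ l} hcon (by
        intro x hx y hxy hy
        exact hx (mem_of_mem_pathEdges (h.tight _ hxy y hy (by simp)) (Sym2.mem_mk_left x y)))
      have : w ∉ W := fun hwW => hw (hall w hwW)
      have := hF.deg_outside w this
      omega
    refine hasHamiltonCycle_of_list h.nodup hmem ?_ (h.edges.trans hMM) hr hr' (by simp)
    refine hcard.trans ?_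
    rw [← Finset.card_univ]
    refine (Finset.card_le_card (t := l.toFinset) fun v _ => by simp [hmem v]).trans
      (List.toFinset_card_le l)

/-- In an attached configuration on an expanding core there is an unclaimed edge that completes a
Hamilton cycle or lengthens a longest good path. -/
theorem exists_booster {B : Finset (Sym2 V)} {Q : List V} (hF : IsAttached F W P)
    (hE : IsExpander M W P a) (hFM : F ⊆ M) (hcard : 3 ≤ Fintype.card V) (ha : 1 ≤ a)
    (hQ : GoodPath M F W Q) (hQne : Q ≠ [])
    (hmax : ∀ l, GoodPath M F W l → coreCount W l ≤ coreCount W Q)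
    (hham : ¬ HasHamiltonCycle M) (hB : 2 * B.card < a * a) :
    ∃ e ∈ freeEdges M B, HasHamiltonCycle (insert e M) ∨
      ∃ l, GoodPath (insert e M) F W l ∧ coreCount W Q < coreCount W l := by
  have hstuck : ∀ Q' : List V, Q'.Perm Q → GoodPath M F W Q' → ∀ r ∈ rotationEnds M P Q',
      ∀ x ∈ P, s(r, x) ∈ M → x ∈ Q' := by
    intro Q' hp hQ' r hr x hx hrx
    by_contra hxQ
    obtain ⟨l, hl, hlr⟩ := mem_rotationEnds.1 hr
    obtain ⟨d, rfl⟩ := List.getLast?_eq_some_iff.1 hlr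
    have hxl : x ∉ d ++ [r] := fun hm => hxQ (hl.perm.mem_iff.1 hm)
    obtain ⟨c, hc⟩ := (hl.goodPath hF hQ').extend hF hFM (hF.subset hx) hxl hrx
    have h1 := hmax _ hc
    rw [← coreCount_congr (hl.perm.trans hp)] at h1
    have h2 := coreCount_lt_append (l' := x :: c) (hF.subset hx) hxl (by simp)
    omega
  have hmany : ∀ Q' : List V, Q'.Perm Q → GoodPath M F W Q' → a ≤ (rotationEnds M P Q').card :=
    fun Q' hp hQ' => (lt_card_rotationEnds hF hE hQ'
      (fun h => hQne (by subst h; exact hp.nil_eq.symm)) (hstuck Q' hp hQ')).le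
  classical
  -- the ordered pairs of ends of rotations of `Q`
  let S : Finset (V × V) := Finset.univ.filter fun p =>
    ∃ l, l.Perm Q ∧ GoodPath M F W l ∧ l.head? = some p.1 ∧ l.getLast? = some p.2
  have hS : a * a ≤ S.card := by
    have hsub : ((rotationEnds M P Q).sigma
        (fun r => Finset.univ.filter fun r' => (r, r') ∈ S)).card ≤ S.card := by
      apply Finset.card_le_card_of_injOn (fun p => (p.1, p.2))
      · intro p hp
        simpa using (Finset.mem_filter.1 (Finset.mem_sigma.1 hp).2).2
      · rintro ⟨p1, p2⟩ _ ⟨q1, q2⟩ _ h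
        simp at h
        obtain ⟨rfl, rfl⟩ := h
        rfl
    refine le_trans ?_ hsub
    rw [Finset.card_sigma]
    refine le_trans ?_ (Finset.card_nsmul_le_sum _ _ a ?_)
    · rw [smul_eq_mul]
      exact Nat.mul_le_mul_right _ (hmany Q (.refl _) hQ)
    · intro r hr
      obtain ⟨l, hl, hlr⟩ := mem_rotationEnds.1 hr
      have hp : l.reverse.Perm Q := (List.reverse_perm l).trans hl.perm
      have hg := (hl.goodPath hF hQ).reverse
      refine (hmany l.reverse hp hg).trans (Finset.card_le_card fun r' hr' => ?_)
      obtain ⟨l', hl', hlr'⟩ := mem_rotationEnds.1 hr'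
      simp only [Finset.mem_filter, Finset.mem_univ, true_and, S]
      refine ⟨l', hl'.perm.trans hp, hl'.goodPath hF hg, ?_, hlr'⟩
      rw [hl'.head?, List.head?_reverse, hlr]
  have himage : a * a ≤ 2 * (S.image fun p => s(p.1, p.2)).card := by
    refine hS.trans (Finset.card_le_mul_card_image _ _ fun e _ => ?_)
    induction e with | _ x y
    refine (Finset.card_le_card (t := {(x, y), (y, x)}) fun p hp => ?_).trans Finset.card_le_two
    have := (Finset.mem_filter.1 hp).2
    rw [Sym2.eq_iff] at this
    simp only [Finset.mem_insert, Finset.mem_singleton]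
    rcases this with ⟨h1, h2⟩ | ⟨h1, h2⟩
    · left; ext <;> assumption
    · right; ext <;> assumption
  obtain ⟨e, he, heB⟩ : ∃ e ∈ S.image (fun p => s(p.1, p.2)), e ∉ B := by
    by_contra hcon
    push Not at hcon
    have := Finset.card_le_card (s := S.image fun p => s(p.1, p.2)) (t := B) hcon
    omega
  rw [Finset.mem_image] at he
  obtain ⟨⟨r, r'⟩, hp, rfl⟩ := he
  obtain ⟨l, hlp, hlg, hr, hr'⟩ := (Finset.mem_filter.1 hp).2
  simp only at hr hr' heB ⊢
  have hlne : l ≠ [] := by rintro rfl; simp at hr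
  have hgt := lt_card_rotationEnds hF hE hlg hlne (hstuck l hlp hlg)
  have hne : r ≠ r' := by
    rintro rfl
    rcases l with _ | ⟨w, _ | ⟨z, t⟩⟩
    · simp at hr
    · have : rotationEnds M P [w] ⊆ {w} := fun v hv => by
        simpa using mem_of_mem_rotationEnds hv
      have := Finset.card_le_card this
      rw [Finset.card_singleton] at this
      omega
    · simp only [List.head?_cons, Option.some.injEq] at hr
      subst hr
      rw [List.getLast?_cons_cons] at hr'
      exact (List.nodup_cons.1 hlg.nodup).1 (List.mem_of_getLast? hr')
  have hcl := hlg.close hF hFM hcard hr hr' (exists_missing_adjacent hE hF.subset ha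
    (rotationEnds_subset hF hlg) (fun _ => mem_of_mem_rotationEnds) hgt.le (hstuck l hlp hlg))
  rw [coreCount_congr hlp] at hcl
  refine ⟨s(r, r'), ?_, hcl⟩
  unfold freeEdges
  simp only [Finset.mem_sdiff, Finset.mem_union, not_or, SimpleGraph.mem_edgeFinset,
    SimpleGraph.mem_edgeSet, SimpleGraph.top_adj]
  refine ⟨hne, fun hM => ?_, heB⟩
  rw [Finset.insert_eq_of_mem hM] at hcl
  rcases hcl with hcl | ⟨l', hl', hlt⟩
  · exact hham hcl
  · exact absurd (hmax l' hl') (by omega)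

theorem makerWinsFrom_of_hasHamiltonCycle {b : ℕ} (k : ℕ) {B : Finset (Sym2 V)}
    (h : HasHamiltonCycle M) : MakerWinsFrom b k M B := by
  cases k with
  | zero => exact h
  | succ k => exact .inl h

theorem mem_freeEdges {B : Finset (Sym2 V)} {x y : V} :
    s(x, y) ∈ freeEdges M B ↔ x ≠ y ∧ s(x, y) ∉ M ∧ s(x, y) ∉ B := by
  simp [freeEdges]

theorem not_mem_of_mem_freeEdges {B : Finset (Sym2 V)} {e : Sym2 V} (h : e ∈ freeEdges M B) :
    ¬ e.IsDiag ∧ e ∉ M ∧ e ∉ B := by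
  induction e with | _ x y
  simpa [mem_freeEdges] using h

/-- Maker wins from an attached configuration on an expanding core, with one move for each core
vertex that is missing on a good path. -/
theorem makerWinsFrom_of_isAttached {b K : ℕ} (hF : IsAttached F W P)
    (hcard : 3 ≤ Fintype.card V) (ha : 1 ≤ a) (hK : 2 * (b * K) < a * a) :
    ∀ (k : ℕ) (M B : Finset (Sym2 V)), IsExpander M W P a → F ⊆ M → B.card ≤ b * M.card →
      M.card + k ≤ K → (∃ l, l ≠ [] ∧ GoodPath M F W l ∧ W.card + 1 ≤ k + coreCount W l) →
      MakerWinsFrom b k M B := by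
  intro k
  induction k with
  | zero =>
    rintro M B - - - - ⟨l, -, -, hl⟩
    have : coreCount W l ≤ W.card := Finset.card_filter_le _ _
    omega
  | succ k ih =>
    rintro M B hE hFM hB hMk ⟨l, hlne, hlg, hl⟩
    by_cases hham : HasHamiltonCycle M
    · exact .inl hham
    refine .inr fun X hX => ?_
    -- a good path with the most core vertices
    let p : ℕ → Prop := fun m => ∃ l, l ≠ [] ∧ GoodPath M F W l ∧ coreCount W l = m
    classical
    obtain ⟨Q, hQne, hQ, hQm⟩ := Nat.findGreatest_spec (P := p) (n := W.card)
      (Finset.card_filter_le _ _) ⟨l, hlne, hlg, rfl⟩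
    have hmax : ∀ l, GoodPath M F W l → coreCount W l ≤ coreCount W Q := by
      intro l' hl'
      rcases eq_or_ne l' [] with rfl | hne
      · simp [coreCount]
      rw [hQm]
      exact Nat.le_findGreatest (Finset.card_filter_le _ _) ⟨l', hne, hl', rfl⟩
    have hBX : (B ∪ X).card ≤ b * (M.card + 1) := by
      refine (Finset.card_union_le _ _).trans ?_
      have := hX.2 ▸ min_le_left b (freeEdges M B).card
      rw [mul_add, mul_one]
      omega
    have hBK : b * (M.card + 1) ≤ b * K := Nat.mul_le_mul_left _ (by omega)
    obtain ⟨e, he, hor⟩ := exists_booster (B := B ∪ X) hF hE hFM hcard ha hQ hQne hmax hham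
      (by omega)
    refine ⟨e, he, ?_⟩
    rcases hor with hor | ⟨l', hl', hlt⟩
    · exact makerWinsFrom_of_hasHamiltonCycle _ hor
    have hcardM : (insert e M).card = M.card + 1 :=
      Finset.card_insert_of_notMem (not_mem_of_mem_freeEdges he).2.1
    refine ih _ _ (hE.mono (Finset.subset_insert _ _)) (hFM.trans (Finset.subset_insert _ _))
      (by rw [hcardM]; exact hBX) (by omega) ⟨l', ?_, hl', ?_⟩
    · rintro rfl
      simp [coreCount] at hlt
    · have := hmax l hlg
      omega

end Boosters

/-! ### The box game estimate -/

section Box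

/-- The bound on the danger of a set of `k` active vertices. -/
noncomputable def boxBound (n b s k₀ k : ℕ) : ℝ :=
  k * (s + b * (1 + Real.log (n / k)) + 3 * k₀ - k)

theorem log_succ_div_bounds {k : ℕ} (hk : 1 ≤ k) :
    1 / ((k : ℝ) + 1) ≤ Real.log ((k + 1) / k) ∧ k * Real.log (((k : ℝ) + 1) / k) ≤ 1 := by
  have hk' : (0 : ℝ) < k := by exact_mod_cast hk
  constructor
  · have h := Real.one_sub_inv_le_log_of_pos (x := ((k : ℝ) + 1) / k) (by positivity)
    refine le_trans (le_of_eq ?_) h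
    field_simp
    ring
  · have h := Real.log_le_sub_one_of_pos (x := ((k : ℝ) + 1) / k) (by positivity)
    calc k * Real.log (((k : ℝ) + 1) / k) ≤ k * (((k : ℝ) + 1) / k - 1) := by gcongr
      _ = 1 := by field_simp; ring

theorem log_div_eq {n k : ℕ} (hn : 1 ≤ n) (hk : 1 ≤ k) :
    Real.log ((n : ℝ) / k) = Real.log (n / ((k : ℝ) + 1)) + Real.log ((k + 1) / k) := by
  have hk' : (0 : ℝ) < k := by exact_mod_cast hk
  have hn' : (0 : ℝ) < n := by exact_mod_cast hn
  rw [← Real.log_mul (by positivity) (by positivity)]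
  congr 1
  field_simp

/-- The bound survives the removal of a vertex of at least average danger. -/
theorem boxBound_remove {n b s k₀ k : ℕ} (hn : 1 ≤ n) (hk : 1 ≤ k) :
    k * (boxBound n b s k₀ (k + 1) + b + k) ≤ (k + 1) * boxBound n b s k₀ k := by
  have hk' : (0 : ℝ) < k := by exact_mod_cast hk
  have h1 := (log_succ_div_bounds hk).1
  have h2 := log_div_eq hn hk
  unfold boxBound
  push_cast
  set u := Real.log (n / ((k : ℝ) + 1))
  set w := Real.log (((k : ℝ) + 1) / k)
  rw [h2]
  have h3 : 1 ≤ (k + 1) * w := by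
    rw [div_le_iff₀ (by positivity)] at h1; linarith
  have h4 : (0 : ℝ) ≤ k * (b * ((k + 1) * w - 1)) := by
    have : (0 : ℝ) ≤ (k + 1) * w - 1 := by linarith
    positivity
  nlinarith

/-- The bound leaves room for further vertices of danger at most `s`. -/
theorem boxBound_add_le {n b s k₀ : ℕ} (hn : k₀ ≤ n) (k m : ℕ) (hkm : k + m ≤ k₀) :
    boxBound n b s k₀ k + m * s ≤ boxBound n b s k₀ (k + m) := by
  induction m with
  | zero => simp
  | succ m ih =>
    have ih := ih (by omega)
    suffices h : ∀ q : ℕ, q + 1 ≤ k₀ → boxBound n b s k₀ q + s ≤ boxBound n b s k₀ (q + 1) by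
      have := h (k + m) (by omega)
      rw [show k + (m + 1) = k + m + 1 by ring]
      push_cast
      linarith
    intro q hq
    have hn1 : (q + 1 : ℝ) ≤ n := by exact_mod_cast hq.trans hn
    have hq0 : (q + 1 : ℝ) ≤ k₀ := by exact_mod_cast hq
    have hlog : 0 ≤ Real.log (n / ((q : ℝ) + 1)) := by
      apply Real.log_nonneg
      rw [le_div_iff₀ (by positivity)]
      linarith
    unfold boxBound
    push_cast
    rcases Nat.eq_zero_or_pos q with rfl | hqp
    · norm_num at hlog hq0 ⊢
      have : 0 ≤ (b : ℝ) * (1 + Real.log n) := by positivity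
      have : (1 : ℝ) ≤ k₀ := by exact_mod_cast hq0
      linarith
    · have h1 := (log_succ_div_bounds hqp).2
      have h2 := log_div_eq (n := n) (by omega) hqp
      rw [h2]
      set u := Real.log (n / ((q : ℝ) + 1))
      set w := Real.log (((q : ℝ) + 1) / q)
      have h3 : (0 : ℝ) ≤ b * (1 + u - q * w) := by
        have : (0 : ℝ) ≤ 1 + u - q * w := by linarith
        positivity
      nlinarith

variable {V : Type*} [Fintype V] [DecidableEq V]

/-- The vertices that Maker treats as urgent: outside an exempt set `S`, those in `Z` and those
of large degree in Breaker's graph. -/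
def urgent (s : ℕ) (S Z : Finset V) (B : Finset (Sym2 V)) : Finset V :=
  Finset.univ.filter fun v => v ∉ S ∧ (s < deg B v ∨ v ∈ Z)

/-- The urgent vertices that are not yet inner vertices of the linear forest. -/
def active (s : ℕ) (S Z : Finset V) (B F : Finset (Sym2 V)) : Finset V :=
  (urgent s S Z B).filter fun v => deg F v < 2

/-- Breaker's edges at a set of active vertices, discounted by `b` for each forest edge there, are
bounded by `boxBound`, up to the slack `c`. -/
def BoxBounded (b s k₀ : ℕ) (A₀ : Finset V) (B F : Finset (Sym2 V)) (c : ℝ) : Prop :=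
  ∀ A ⊆ A₀, (touch B A : ℝ) - b * ∑ v ∈ A, (deg F v : ℝ) ≤
    boxBound (Fintype.card V) b s k₀ A.card + c

theorem BoxBounded.grow {b s k₀ c : ℕ} {A₀ A₁ : Finset V} {B B' F : Finset (Sym2 V)}
    (h : BoxBounded b s k₀ A₀ B F 0) (hk₀ : k₀ ≤ Fintype.card V) (hA₁ : A₁.card ≤ k₀)
    (hnew : ∀ v ∈ A₁, v ∉ A₀ → deg B v ≤ s) (hB : ∀ A, touch B' A ≤ touch B A + c) :
    BoxBounded b s k₀ A₁ B' F c := by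
  intro A hA
  have h1 := h (A.filter (· ∈ A₀)) fun v hv => (Finset.mem_filter.1 hv).2
  have h2 := touch_le_touch_add_sum B (A.filter (· ∈ A₀)) (A.filter (· ∉ A₀))
  rw [Finset.filter_union_filter_not_eq] at h2
  have h3 : ∑ v ∈ A.filter (· ∉ A₀), deg B v ≤ (A.filter (· ∉ A₀)).card * s := by
    rw [← smul_eq_mul]
    refine Finset.sum_le_card_nsmul _ _ _ fun v hv => ?_
    rw [Finset.mem_filter] at hv
    exact hnew v (hA hv.1) hv.2
  have h4 := Finset.card_filter_add_card_filter_not (s := A) (· ∈ A₀)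
  have h5 := boxBound_add_le (b := b) (s := s) hk₀ (A.filter (· ∈ A₀)).card
    (A.filter (· ∉ A₀)).card (by rw [h4]; exact (Finset.card_le_card hA).trans hA₁)
  rw [h4] at h5
  have h6 : ∑ v ∈ A.filter (· ∈ A₀), (deg F v : ℝ) ≤ ∑ v ∈ A, (deg F v : ℝ) :=
    Finset.sum_le_sum_of_subset_of_nonneg (Finset.filter_subset _ _) fun _ _ _ => by positivity
  have h7 : (touch B' A : ℝ) ≤ touch B (A.filter (· ∈ A₀)) + (A.filter (· ∉ A₀)).card * s + c := by
    exact_mod_cast (hB A).trans (by omega)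
  have h8 : (b : ℝ) * ∑ v ∈ A.filter (· ∈ A₀), (deg F v : ℝ) ≤ b * ∑ v ∈ A, (deg F v : ℝ) := by
    gcongr
  linarith

/-- After a turn of Breaker, a forest edge at a most dangerous active vertex restores the bound. -/
theorem BoxBounded.tend {b s k₀ : ℕ} {A₀ A₁ : Finset V} {B F F' : Finset (Sym2 V)} {v : V}
    (h : BoxBounded b s k₀ A₀ B F b) (hv : v ∈ A₀)
    (hmax : ∀ u ∈ A₀, (deg B u : ℝ) - b * deg F u ≤ deg B v - b * deg F v) (hsub : A₁ ⊆ A₀)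
    (hF : ∀ u ∈ A₀, deg F' u = deg F u + if u = v then 1 else 0) :
    BoxBounded b s k₀ A₁ B F' 0 := by
  have hn : 1 ≤ Fintype.card V := Fintype.card_pos_iff.2 ⟨v⟩
  intro A hA
  have hsum : ∑ u ∈ A, (deg F' u : ℝ) = ∑ u ∈ A, (deg F u : ℝ) + if v ∈ A then 1 else 0 := by
    rw [Finset.sum_congr rfl (g := fun u => (deg F u : ℝ) + if u = v then 1 else 0)]
    · rw [Finset.sum_add_distrib, Finset.sum_ite_eq']
    · intro u hu
      rw [hF u (hsub (hA hu))]
      push_cast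
      rfl
  rw [hsum]
  by_cases hvA : v ∈ A
  · have := h A (hA.trans hsub)
    rw [if_pos hvA]
    linarith
  rw [if_neg hvA, add_zero]
  rcases A.eq_empty_or_nonempty with rfl | hne
  · simp [touch, boxBound]
  -- `v` is at least as dangerous as the average vertex of `A`
  have h1 := h (insert v A) (by
    rw [Finset.insert_subset_iff]
    exact ⟨hv, hA.trans hsub⟩)
  rw [Finset.sum_insert hvA, Finset.card_insert_of_notMem hvA] at h1
  have h2 : (touch B A : ℝ) + deg B v ≤ touch B (insert v A) + A.card := by
    exact_mod_cast touch_add_deg_le B hvA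
  have h3 : (touch B A : ℝ) ≤ ∑ u ∈ A, (deg B u : ℝ) := by
    exact_mod_cast touch_le_sum_deg B A
  have h4 : ∑ u ∈ A, ((deg B u : ℝ) - b * deg F u) ≤ A.card * (deg B v - b * deg F v) := by
    rw [← nsmul_eq_mul]
    exact Finset.sum_le_card_nsmul _ _ _ fun u hu => hmax u (hsub (hA hu))
  rw [Finset.sum_sub_distrib, ← Finset.mul_sum] at h4
  have hk : 1 ≤ A.card := hne.card_pos
  have h5 := boxBound_remove (b := b) (s := s) (k₀ := k₀) hn hk
  have hk' : (0 : ℝ) < A.card := by exact_mod_cast hk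
  set D := (touch B A : ℝ) - b * ∑ u ∈ A, (deg F u : ℝ) with hD
  have h6 : D ≤ A.card * (deg B v - b * deg F v) := by linarith
  have h7 : D + (deg B v - b * deg F v) ≤
      boxBound (Fintype.card V) b s k₀ (A.card + 1) + b + A.card := by
    rw [mul_add] at h1
    linarith
  have h8 : (A.card + 1) * D ≤ (A.card + 1) * boxBound (Fintype.card V) b s k₀ A.card := by
    nlinarith
  have := le_of_mul_le_mul_left h8 (by positivity)
  linarith

end Box

/-! ### Urgent moves -/

section Urgent

variable {V : Type*} [Fintype V] [DecidableEq V]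

/-- An end `v` of a linear forest may be joined to any other vertex `x`, after deletion of at most
one edge at `x`. -/
theorem IsLinearForest.exists_reattach {F : Finset (Sym2 V)} (hF : IsLinearForest F) {v x : V}
    (hv : deg F v ≤ 1) (hvx : v ≠ x) (hnot : s(v, x) ∉ F) :
    ∃ F₀, (F₀ = F ∨ ∃ y, s(x, y) ∈ F ∧ F₀ = F.erase s(x, y)) ∧
      IsLinearForest (insert s(v, x) F₀) := by
  obtain ⟨c, hn, hcF, ht⟩ := hF.exists_component hv
  by_cases hx : x ∈ v :: c
  · obtain ⟨l₁, l₂, hl⟩ := List.append_of_mem hx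
    rcases l₁ with _ | ⟨w, d⟩
    · simp only [List.nil_append, List.cons.injEq] at hl
      exact absurd hl.1 hvx
    have hw : w = v := by simp at hl; exact hl.1.symm
    subst hw
    -- the predecessor `y` of `x` on the component of `v`
    obtain ⟨d', y, hd'⟩ : ∃ d' y, w :: d = d' ++ [y] :=
      ⟨_, _, (List.dropLast_append_getLast (l := w :: d) (by simp)).symm⟩
    rw [hl] at hn hcF ht
    have hE : pathEdges (w :: d ++ x :: l₂) =
        insert s(y, x) (pathEdges (w :: d) ∪ pathEdges (x :: l₂)) := by
      rw [hd', List.append_assoc, List.singleton_append, pathEdges_append_cons_cons]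
    have hxd : x ∉ w :: d := fun h => (List.nodup_append.1 hn).2.2 x h x (by simp) rfl
    have hyF : s(x, y) ∈ F := hcF (by rw [hE, Sym2.eq_swap]; exact Finset.mem_insert_self _ _)
    refine ⟨F.erase s(x, y), .inr ⟨y, hyF, rfl⟩, ?_⟩
    have hdx := deg_erase hyF x
    rw [if_pos (by simp)] at hdx
    have h2 := hF.deg_le_two x
    refine (hF.erase_edge hyF).insert_edge (c := d) (List.nodup_append.1 hn).1 ?_ ?_ hxd
      ((deg_mono (Finset.erase_subset _ _) w).trans hv) (by omega)
    · intro e he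
      rw [Finset.mem_erase]
      refine ⟨?_, hcF (by rw [hE]; exact Finset.mem_insert_of_mem (Finset.mem_union_left _ he))⟩
      rintro rfl
      exact hxd (mem_of_mem_pathEdges he (by simp))
    · intro e he z hz hze
      rw [Finset.mem_erase] at he
      have := ht e he.2 z (List.mem_append_left _ hz) hze
      rw [hE, Finset.mem_insert, Finset.mem_union, Sym2.eq_swap] at this
      rcases this with this | this | this
      · exact absurd this he.1
      · exact this
      · exact absurd rfl ((List.nodup_append.1 hn).2.2 z hz z (mem_of_mem_pathEdges this hze))
  · by_cases hd : deg F x ≤ 1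
    · exact ⟨F, .inl rfl, hF.insert_edge hn hcF ht hx hv hd⟩
    obtain ⟨y, hy⟩ := exists_mem_of_deg_pos (S := F) (v := x) (by omega)
    refine ⟨F.erase s(x, y), .inr ⟨y, hy, rfl⟩, ?_⟩
    have hdx := deg_erase hy x
    rw [if_pos (by simp)] at hdx
    have h2 := hF.deg_le_two x
    refine (hF.erase_edge hy).insert_edge hn ?_ ?_ hx
      ((deg_mono (Finset.erase_subset _ _) v).trans hv) (by omega)
    · intro e he
      rw [Finset.mem_erase]
      refine ⟨?_, hcF he⟩
      rintro rfl
      exact hx (mem_of_mem_pathEdges he (by simp))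
    · intro e he z hz hze
      exact ht e (Finset.mem_of_mem_erase he) z hz hze

/-- The numerical relations between the number `n` of vertices, the bias `b`, the scale `s` of
order `n / √(ln n)` and the total number `K` of turns. -/
structure Scale (n b s K : ℕ) : Prop where
  one_le : 1 ≤ s
  mul_le : b * K ≤ 2 * s ^ 2
  le_turns : n + 4000000 * s ≤ K
  log_le : (b : ℝ) * (Real.log n + 3) + 4000000 * s ≤ n

/-- The invariant of the game between two rounds. Maker keeps a linear forest `F` of her edges,
without edges inside the core `W`; her other edges are the at most `j` core edges and the discarded
forest edges, of which there is at most one for each forest edge at an urgent vertex. -/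
structure Invariant (b s : ℕ) (W S Z : Finset V) (M B F : Finset (Sym2 V)) (j : ℕ) : Prop where
  subset : F ⊆ M
  forest : IsLinearForest F
  loopless_maker : ∀ e ∈ M, ¬ e.IsDiag
  loopless_breaker : ∀ e ∈ B, ¬ e.IsDiag
  card_breaker : B.card ≤ b * M.card
  forest_core : ∀ e ∈ F, e ∉ W.sym2
  card_core : (M.filter (· ∈ W.sym2)).card ≤ j
  card_discarded : ((M \ F).filter (· ∉ W.sym2)).card ≤ ∑ v ∈ urgent s S Z B, deg F v
  box : BoxBounded b s (11 * s) (active s S Z B F) B F 0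

variable {b s K j : ℕ} {W S Z : Finset V} {M B F X : Finset (Sym2 V)}

theorem urgent_mono {B' : Finset (Sym2 V)} (h : B ⊆ B') : urgent s S Z B ⊆ urgent s S Z B' := by
  intro v hv
  simp only [urgent, Finset.mem_filter, Finset.mem_univ, true_and] at hv ⊢
  exact ⟨hv.1, hv.2.imp (fun h1 => h1.trans_le (deg_mono h v)) id⟩

theorem card_heavy_le (hB : ∀ e ∈ B, ¬ e.IsDiag) (hcard : B.card ≤ 2 * s ^ 2) :
    (Finset.univ.filter fun v => s < deg B v).card ≤ 4 * s := by
  have h1 := card_filter_lt_deg_mul_le hB s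
  by_contra hlt
  push Not at hlt
  have : (4 * s + 1) * (s + 1) ≤
      (Finset.univ.filter fun v => s < deg B v).card * (s + 1) := Nat.mul_le_mul_right _ hlt
  nlinarith

/-- Few vertices are ever urgent. -/
theorem card_urgent_le (hB : ∀ e ∈ B, ¬ e.IsDiag) (hcard : B.card ≤ 2 * s ^ 2)
    (hZ : Z.card ≤ 7 * s) : (urgent s S Z B).card ≤ 11 * s := by
  have h2 : urgent s S Z B ⊆ (Finset.univ.filter fun v => s < deg B v) ∪ Z := by
    intro v hv
    simp only [urgent, Finset.mem_filter, Finset.mem_univ, true_and, Finset.mem_union] at hv ⊢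
    exact hv.2
  have h3 := (Finset.card_le_card h2).trans (Finset.card_union_le _ _)
  have h4 := card_heavy_le hB hcard
  omega

theorem sum_deg_urgent_le (hF : IsLinearForest F) (h : (urgent s S Z B).card ≤ 11 * s) :
    ∑ v ∈ urgent s S Z B, deg F v ≤ 22 * s := by
  have := Finset.sum_le_card_nsmul (urgent s S Z B) (fun v => deg F v) 2 fun v _ => hF.deg_le_two v
  rw [smul_eq_mul] at this
  omega

theorem IsLinearForest.card_le (hF : IsLinearForest F) : F.card ≤ Fintype.card V := by
  have h1 := sum_deg hF.loopless
  have h2 := Finset.sum_le_card_nsmul Finset.univ (fun v => deg F v) 2 fun v _ => hF.deg_le_two v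
  rw [smul_eq_mul, Finset.card_univ] at h2
  omega

/-- The number of turns played is controlled by the forest, the core edges and the urgent moves. -/
theorem Invariant.card_maker_le (h : Invariant b s W S Z M B F j) :
    M.card ≤ j + F.card + ∑ v ∈ urgent s S Z B, deg F v := by
  have h1 : M ⊆ M.filter (· ∈ W.sym2) ∪ F ∪ (M \ F).filter (· ∉ W.sym2) := by
    intro e he
    simp only [Finset.mem_union, Finset.mem_filter, Finset.mem_sdiff]
    tauto
  have h2 := Finset.card_le_card h1
  have h3 := Finset.card_union_le (M.filter (· ∈ W.sym2) ∪ F) ((M \ F).filter (· ∉ W.sym2))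
  have h4 := Finset.card_union_le (M.filter (· ∈ W.sym2)) F
  have := h.card_core
  have := h.card_discarded
  omega

/-- The number of Maker's edges at a vertex. -/
theorem Invariant.deg_maker_le (h : Invariant b s W S Z M B F j) (v : V) :
    deg M v ≤ deg F v + deg (M.filter (· ∈ W.sym2)) v + ∑ v ∈ urgent s S Z B, deg F v := by
  have h1 : M ⊆ F ∪ M.filter (· ∈ W.sym2) ∪ (M \ F).filter (· ∉ W.sym2) := by
    intro e he
    simp only [Finset.mem_union, Finset.mem_filter, Finset.mem_sdiff]
    tauto
  have h2 := deg_mono h1 v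
  have h3 := deg_union_le (F ∪ M.filter (· ∈ W.sym2)) ((M \ F).filter (· ∉ W.sym2)) v
  have h4 := deg_union_le F (M.filter (· ∈ W.sym2)) v
  have h5 := deg_le_card ((M \ F).filter (· ∉ W.sym2)) v
  have := h.card_discarded
  omega

theorem card_union_turn_le (hcard : B.card ≤ b * M.card) (hX : X.card ≤ b) :
    (B ∪ X).card ≤ b * (M.card + 1) := by
  have := Finset.card_union_le B X
  rw [mul_add, mul_one]
  omega

theorem Scale.card_breaker_le {n : ℕ} (hsc : Scale n b s K) (hcard : B.card ≤ b * M.card)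
    (hX : X.card ≤ b) (hMK : M.card < K) : (B ∪ X).card ≤ 2 * s ^ 2 :=
  (card_union_turn_le hcard hX).trans ((Nat.mul_le_mul_left b hMK).trans hsc.mul_le)

/-- Far fewer than `K` turns have been played as long as the invariant holds. -/
theorem Invariant.card_maker_lt (h : Invariant b s W S Z M B F j)
    (hsc : Scale (Fintype.card V) b s K) (hZ : Z.card ≤ 7 * s) (hj : j ≤ 3000000 * s + 1)
    (hMK : M.card ≤ K) : M.card + 300 * s < K := by
  have hB : B.card ≤ 2 * s ^ 2 :=
    h.card_breaker.trans ((Nat.mul_le_mul_left b hMK).trans hsc.mul_le)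
  have h1 := card_urgent_le (S := S) h.loopless_breaker hB hZ
  have h2 := sum_deg_urgent_le h.forest h1
  have h3 := h.card_maker_le
  have h4 := h.forest.card_le
  have h5 := hsc.le_turns
  have h6 := hsc.one_le
  omega

theorem Scale.le_card (hsc : Scale (Fintype.card V) b s K) : 4000000 * s ≤ Fintype.card V := by
  have h := hsc.log_le
  have h1 : 0 ≤ (b : ℝ) * (Real.log (Fintype.card V) + 3) := by
    have := Real.log_natCast_nonneg (Fintype.card V)
    positivity
  have : (4000000 * s : ℝ) ≤ Fintype.card V := by linarith
  exact_mod_cast this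

/-- The urgent move: if some vertex is active after Breaker's turn, Maker joins a most dangerous
one to a vertex away from the core and from the urgent vertices, so that no other vertex of these
changes its degree in the forest. -/
theorem Invariant.exists_urgent_move (h : Invariant b s W S Z M B F j)
    (hsc : Scale (Fintype.card V) b s K) (hW : W.card ≤ 200 * s) (hZ : Z.card ≤ 7 * s)
    (hj : j ≤ 3000000 * s + 1) (hMK : M.card < K) (hX : X.card ≤ b) (hXd : ∀ e ∈ X, ¬ e.IsDiag)
    (hact : (active s S Z (B ∪ X) F).Nonempty) :
    ∃ v ∈ active s S Z (B ∪ X) F, ∃ e ∈ freeEdges M (B ∪ X), ∃ F',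
      Invariant b s W S Z (insert e M) (B ∪ X) F' j ∧
      (∀ z ∈ W ∪ urgent s S Z (B ∪ X), deg F' z = deg F z + if z = v then 1 else 0) ∧
      F.card ≤ F'.card := by
  have hs := hsc.one_le
  have hBd : ∀ e ∈ B ∪ X, ¬ e.IsDiag := fun e he =>
    (Finset.mem_union.1 he).elim (h.loopless_breaker e) (hXd e)
  have hBcard := hsc.card_breaker_le h.card_breaker hX hMK
  have hU := card_urgent_le (S := S) (Z := Z) hBd hBcard hZ
  have hUsub : urgent s S Z B ⊆ urgent s S Z (B ∪ X) := urgent_mono Finset.subset_union_left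
  have hUold : (urgent s S Z B).card ≤ 11 * s := (Finset.card_le_card hUsub).trans hU
  have hn := hsc.le_card
  have hbox : BoxBounded b s (11 * s) (active s S Z (B ∪ X) F) (B ∪ X) F b := by
    refine h.box.grow (by omega) ((Finset.card_filter_le _ _).trans hU) ?_ ?_
    · intro v hv hv'
      simp only [active, urgent, Finset.mem_filter, Finset.mem_univ, true_and] at hv hv'
      by_contra hlt
      push Not at hlt
      exact hv' ⟨⟨hv.1.1, .inl hlt⟩, hv.2⟩
    · intro A
      exact (touch_union_le B X A).trans (Nat.add_le_add_left hX _)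
  obtain ⟨v, hv, hmax⟩ := Finset.exists_max_image (active s S Z (B ∪ X) F)
    (fun u => (deg (B ∪ X) u : ℝ) - b * deg F u) hact
  have hvU : v ∈ urgent s S Z (B ∪ X) := (Finset.mem_filter.1 hv).1
  have hvF : deg F v ≤ 1 := Nat.lt_succ_iff.1 (Finset.mem_filter.1 hv).2
  have hdegB : (deg (B ∪ X) v : ℝ) ≤ b * (Real.log (Fintype.card V) + 3) + 34 * s := by
    have h1 := hbox {v} (by simpa using hv)
    rw [touch_singleton] at h1
    simp only [Finset.sum_singleton, Finset.card_singleton, boxBound] at h1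
    push_cast at h1
    rw [div_one] at h1
    have h2 : (b : ℝ) * deg F v ≤ b * 1 := by
      have : (deg F v : ℝ) ≤ 1 := by exact_mod_cast hvF
      gcongr
    linarith
  have hdegM : deg M v ≤ 1 + j + 22 * s := by
    have h1 := h.deg_maker_le v
    have h2 := deg_le_card (M.filter (· ∈ W.sym2)) v
    have h3 := h.card_core
    have h4 := sum_deg_urgent_le h.forest hUold
    omega
  set D := W ∪ urgent s S Z (B ∪ X) with hD
  have hDcard : D.card ≤ 211 * s := (Finset.card_union_le _ _).trans (by omega)
  obtain ⟨x, hx⟩ : ∃ x, x ∉ {v} ∪ (Finset.univ.filter fun x => s(v, x) ∈ B ∪ X) ∪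
      (Finset.univ.filter fun x => s(v, x) ∈ M) ∪ D ∪
      D.biUnion fun z => Finset.univ.filter fun x => s(z, x) ∈ F := by
    by_contra hcon
    push Not at hcon
    have h1 := Finset.card_le_card (s := Finset.univ) fun x _ => hcon x
    rw [Finset.card_univ] at h1
    have h2 := h1.trans ((Finset.card_union_le _ _).trans (Nat.add_le_add_right
      ((Finset.card_union_le _ _).trans (Nat.add_le_add_right ((Finset.card_union_le _ _).trans
      (Nat.add_le_add_right (Finset.card_union_le _ _) _)) _)) _))
    have h3 := card_neighbors_le (B ∪ X) v
    have h4 := card_neighbors_le M v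
    have h5 := Finset.card_biUnion_le_card_mul D
      (fun z => Finset.univ.filter fun x => s(z, x) ∈ F) 2
      (fun z _ => (card_neighbors_le F z).trans (h.forest.deg_le_two z))
    rw [Finset.card_singleton] at h2
    have h6 : Fintype.card V ≤ deg (B ∪ X) v + (3000000 * s + 656 * s + 3) := by omega
    have h7 : (Fintype.card V : ℝ) ≤ deg (B ∪ X) v + (3000000 * s + 656 * s + 3) := by
      exact_mod_cast h6
    have h8 := hsc.log_le
    have h9 : (1 : ℝ) ≤ s := by exact_mod_cast hs
    linarith
  simp only [Finset.mem_union, Finset.mem_singleton, Finset.mem_filter, Finset.mem_univ, true_and,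
    Finset.mem_biUnion, not_or, not_exists, not_and] at hx
  obtain ⟨⟨⟨⟨hxv, hxB⟩, hxM⟩, hxD⟩, hxF⟩ := hx
  have hxD' : x ∉ D := by
    rw [hD, Finset.mem_union]
    exact not_or.2 (by simpa [hD] using hxD)
  have he : s(v, x) ∈ freeEdges M (B ∪ X) := by
    rw [mem_freeEdges, Finset.mem_union]
    exact ⟨fun h => hxv h.symm, hxM, not_or.2 hxB⟩
  have hnotF : s(v, x) ∉ F := fun hm => hxM (h.subset hm)
  obtain ⟨F₀, hF₀, hforest⟩ := h.forest.exists_reattach hvF (fun h => hxv h.symm) hnotF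
  have hF₀F : F₀ ⊆ F := by
    rcases hF₀ with rfl | ⟨y, -, rfl⟩
    · exact subset_rfl
    · exact Finset.erase_subset _ _
  have hnotF₀ : s(v, x) ∉ F₀ := fun hm => hnotF (hF₀F hm)
  have hdeg : ∀ z ∈ D, deg (insert s(v, x) F₀) z = deg F z + if z = v then 1 else 0 := by
    intro z hz
    have hzx : z ≠ x := by rintro rfl; exact hxD' hz
    rw [deg_insert hnotF₀]
    have h1 : deg F₀ z = deg F z := by
      rcases hF₀ with rfl | ⟨y, hy, rfl⟩
      · rfl
      · have h2 := deg_erase hy z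
        rw [if_neg] at h2
        · exact h2
        rw [Sym2.mem_iff]
        rintro (h3 | rfl)
        · exact hzx h3
        · exact hxF z (by simpa [hD] using hz) (by rw [Sym2.eq_swap]; exact hy)
    rw [h1]
    simp [Sym2.mem_iff, hzx]
  have hdegU : ∀ z ∈ urgent s S Z (B ∪ X),
      deg (insert s(v, x) F₀) z = deg F z + if z = v then 1 else 0 :=
    fun z hz => hdeg z (Finset.mem_union_right _ hz)
  have hxW : x ∉ W := fun hm => hxD' (Finset.mem_union_left _ hm)
  have heW : s(v, x) ∉ W.sym2 := by
    rw [Finset.mk_mem_sym2_iff]; tauto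
  have hcardM : (insert s(v, x) M).card = M.card + 1 := Finset.card_insert_of_notMem hxM
  refine ⟨v, hv, s(v, x), he, insert s(v, x) F₀,
    ⟨?_, hforest, ?_, hBd, ?_, ?_, ?_, ?_, ?_⟩, hdeg, ?_⟩
  · exact Finset.insert_subset_insert _ (hF₀F.trans h.subset)
  · intro f hf
    rw [Finset.mem_insert] at hf
    rcases hf with rfl | hf
    · exact (not_mem_of_mem_freeEdges he).1
    · exact h.loopless_maker f hf
  · rw [hcardM]; exact card_union_turn_le h.card_breaker hX
  · intro f hf
    rw [Finset.mem_insert] at hf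
    rcases hf with rfl | hf
    · exact heW
    · exact h.forest_core f (hF₀F hf)
  · rw [Finset.filter_insert, if_neg heW]; exact h.card_core
  · rw [Finset.sum_congr rfl hdegU, Finset.sum_add_distrib, Finset.sum_ite_eq', if_pos hvU]
    have h1 : ∑ z ∈ urgent s S Z B, deg F z ≤ ∑ z ∈ urgent s S Z (B ∪ X), deg F z :=
      Finset.sum_le_sum_of_subset hUsub
    have h2 := h.card_discarded
    rcases hF₀ with rfl | ⟨y, hy, rfl⟩
    · refine (Finset.card_le_card (Finset.filter_subset_filter _ ?_)).trans
        (h2.trans (h1.trans (Nat.le_succ _)))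
      intro f hf
      simp only [Finset.mem_sdiff, Finset.mem_insert, not_or] at hf ⊢
      exact ⟨hf.1.resolve_left hf.2.1, hf.2.2⟩
    · refine (Finset.card_le_card
        (t := insert s(x, y) ((M \ F).filter (· ∉ W.sym2))) ?_).trans
        ((Finset.card_insert_le _ _).trans (by omega))
      intro f hf
      simp only [Finset.mem_filter, Finset.mem_sdiff, Finset.mem_insert, Finset.mem_erase,
        not_or, not_and] at hf ⊢
      by_cases hfe : f = s(x, y)
      · exact .inl hfe
      · exact .inr ⟨⟨hf.1.1.resolve_left hf.1.2.1, hf.1.2.2 hfe⟩, hf.2⟩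
  · refine hbox.tend hv hmax ?_ fun u hu => hdegU u (Finset.mem_filter.1 hu).1
    intro u hu
    rw [active, Finset.mem_filter] at hu ⊢
    refine ⟨hu.1, ?_⟩
    rw [hdegU u hu.1] at hu
    omega
  · rw [Finset.card_insert_of_notMem hnotF₀]
    rcases hF₀ with rfl | ⟨y, hy, rfl⟩
    · omega
    · rw [Finset.card_erase_of_mem hy]; omega

/-- A move without urgency: if no vertex is active after Breaker's turn, the invariant is preserved
by every move that keeps a linear forest and does not lower degrees. -/
theorem Invariant.of_active_eq_empty (h : Invariant b s W S Z M B F j) (hX : X.card ≤ b)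
    (hXd : ∀ e ∈ X, ¬ e.IsDiag) (hact : active s S Z (B ∪ X) F = ∅) {e : Sym2 V}
    (he : e ∈ freeEdges M (B ∪ X)) {F' : Finset (Sym2 V)} {j' : ℕ} (hFF : F ⊆ F')
    (hF' : IsLinearForest F') (hsub : F' ⊆ insert e M) (hcore : ∀ f ∈ F', f ∉ W.sym2)
    (hj : ((insert e M).filter (· ∈ W.sym2)).card ≤ j') (heF : e ∈ W.sym2 ∨ e ∈ F') :
    Invariant b s W S Z (insert e M) (B ∪ X) F' j' := by
  have hUsub : urgent s S Z B ⊆ urgent s S Z (B ∪ X) := urgent_mono Finset.subset_union_left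
  refine ⟨hsub, hF', ?_, ?_, ?_, hcore, hj, ?_, ?_⟩
  · intro f hf
    rw [Finset.mem_insert] at hf
    rcases hf with rfl | hf
    · exact (not_mem_of_mem_freeEdges he).1
    · exact h.loopless_maker f hf
  · exact fun e he => (Finset.mem_union.1 he).elim (h.loopless_breaker e) (hXd e)
  · rw [Finset.card_insert_of_notMem (not_mem_of_mem_freeEdges he).2.1]
    exact card_union_turn_le h.card_breaker hX
  · refine (Finset.card_le_card ?_).trans (h.card_discarded.trans
      ((Finset.sum_le_sum_of_subset hUsub).trans (Finset.sum_le_sum fun v _ => deg_mono hFF v)))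
    intro f hf
    simp only [Finset.mem_filter, Finset.mem_sdiff, Finset.mem_insert] at hf ⊢
    refine ⟨⟨hf.1.1.resolve_left ?_, fun hm => hf.1.2 (hFF hm)⟩, hf.2⟩
    rintro rfl
    exact heF.elim hf.2 hf.1.2
  · have : active s S Z (B ∪ X) F' = ∅ := by
      rw [Finset.eq_empty_iff_forall_notMem] at hact ⊢
      intro v hv
      rw [active, Finset.mem_filter] at hv
      exact hact v (by rw [active, Finset.mem_filter]; exact ⟨hv.1, (deg_mono hFF v).trans_lt hv.2⟩)
    intro A hA
    rw [this, Finset.subset_empty] at hA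
    subst hA
    simp [touch, boxBound]

end Urgent

/-! ### Joining the paths and attaching them to the core -/

section Attaching

variable {V : Type*} [Fintype V] [DecidableEq V]

/-- The phase of the game in which Maker merges the paths of her forest and attaches the remaining
ones to the expanding core `W'`. The field `attached` says that no path is attached yet, or that
`n - |W'| - |F|` plus the number of attachments, a quantity that no move increases, is at most
`30 s`. The vertices of `W \ W'` are urgent throughout. -/
structure AttachingPhase (b s : ℕ) (W W' P : Finset V) (M B F : Finset (Sym2 V)) : Prop where
  inv : Invariant b s W W' (W \ W') M B F (3000000 * s + 1)
  subset : W' ⊆ W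
  pivots_subset : P ⊆ W'
  card_le : W.card ≤ 200 * s
  card_sdiff_le : (W \ W').card ≤ 7 * s
  le_card_targets : 92 * s ≤ (W' \ P).card
  expander : IsExpander M W' P (3 * s)
  deg_pivot : ∀ x ∈ P, deg F x = 0
  deg_core : ∀ x ∈ W', deg F x ≤ 1
  attached : ∑ x ∈ W', deg F x = 0 ∨
    Fintype.card V + ∑ x ∈ W', deg F x ≤ 30 * s + W'.card + F.card

variable {b s K : ℕ} {W W' P : Finset V} {M B F : Finset (Sym2 V)}

theorem AttachingPhase.sum_deg_core_le (h : AttachingPhase b s W W' P M B F) :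
    ∑ x ∈ W', deg F x ≤ 60 * s := by
  rcases h.attached with h0 | h1
  · omega
  have h2 := sum_deg h.inv.forest.loopless
  have h3 : ∑ v ∈ W'ᶜ, deg F v ≤ W'ᶜ.card * 2 := by
    rw [← smul_eq_mul]
    exact Finset.sum_le_card_nsmul _ _ _ fun v _ => h.inv.forest.deg_le_two v
  rw [← Finset.sum_add_sum_compl W'] at h2
  have h4 := Finset.card_add_card_compl W'
  omega

theorem AttachingPhase.makerWinsFrom (hsc : Scale (Fintype.card V) b s K) :
    ∀ (k : ℕ) (M B F : Finset (Sym2 V)), AttachingPhase b s W W' P M B F → M.card + k = K →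
      MakerWinsFrom b k M B := by
  have hs := hsc.one_le
  have hn := hsc.le_card
  intro k
  induction k with
  | zero =>
    intro M B F h hMk
    have := h.inv.card_maker_lt hsc h.card_sdiff_le le_rfl (by omega)
    omega
  | succ k ih =>
    intro M B F h hMk
    have hlt := h.inv.card_maker_lt hsc h.card_sdiff_le le_rfl (by omega)
    by_cases hdone : ∀ x, x ∉ W' → deg F x = 2
    · have hF : IsAttached F W' P :=
        ⟨h.inv.forest, h.pivots_subset, h.deg_pivot, h.deg_core, hdone⟩
      obtain ⟨y, hy⟩ : W'.Nonempty := by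
        rw [← Finset.card_pos]
        have := Finset.card_le_card (Finset.sdiff_subset (s := W') (t := P))
        have := h.le_card_targets
        omega
      have h1 := h.expander.small {y} (by simpa using hy) (by simp) (by simp; omega)
      obtain ⟨x, hx⟩ := Finset.card_pos.1 (lt_of_lt_of_le (by simp) h1)
      refine makerWinsFrom_of_isAttached (a := 3 * s) (K := K) hF (by omega) (by omega) ?_ _ M B
        h.expander h.inv.subset h.inv.card_breaker (by omega)
        ⟨[x], by simp, goodPath_singleton hF (Finset.mem_filter.1 hx).1, ?_⟩
      · have := hsc.mul_le
        nlinarith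
      · have := Finset.card_le_card h.subset
        have := h.card_le
        omega
    refine .inr fun X hX => ?_
    have hXb : X.card ≤ b := hX.2 ▸ min_le_left _ _
    have hXd : ∀ e ∈ X, ¬ e.IsDiag := fun e he => (not_mem_of_mem_freeEdges (hX.1 he)).1
    by_cases hact : (active s W' (W \ W') (B ∪ X) F).Nonempty
    · obtain ⟨v, hv, e, he, F', hinv, hdeg, hcard⟩ := h.inv.exists_urgent_move hsc h.card_le
        h.card_sdiff_le le_rfl (by omega) hXb hXd hact
      have hvW : v ∉ W' := by
        simp only [active, urgent, Finset.mem_filter] at hv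
        exact hv.1.2.1
      have hdeg' : ∀ z ∈ W', deg F' z = deg F z := by
        intro z hz
        rw [hdeg z (Finset.mem_union_left _ (h.subset hz)), if_neg (by rintro rfl; exact hvW hz),
          add_zero]
      have hcardM : (insert e M).card = M.card + 1 :=
        Finset.card_insert_of_notMem (not_mem_of_mem_freeEdges he).2.1
      refine ⟨e, he, ih _ _ F' ⟨hinv, h.subset, h.pivots_subset, h.card_le, h.card_sdiff_le,
        h.le_card_targets, h.expander.mono (Finset.subset_insert _ _), ?_, ?_, ?_⟩ (by omega)⟩
      · intro x hx
        rw [hdeg' x (h.pivots_subset hx)]; exact h.deg_pivot x hx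
      · intro x hx
        rw [hdeg' x hx]; exact h.deg_core x hx
      · have hsum : ∑ x ∈ W', deg F' x = ∑ x ∈ W', deg F x := Finset.sum_congr rfl hdeg'
        rw [hsum]
        exact h.attached.imp id (by omega)
    -- all vertices of `W \ W'` are inner vertices of the forest
    rw [Finset.not_nonempty_iff_eq_empty] at hact
    have hnact : ∀ v, v ∉ W' → (s < deg (B ∪ X) v ∨ v ∈ W \ W') → 2 ≤ deg F v := by
      intro v hv hor
      by_contra hlt2
      have : v ∈ active s W' (W \ W') (B ∪ X) F := by
        simp only [active, urgent, Finset.mem_filter, Finset.mem_univ, true_and]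
        exact ⟨⟨hv, hor⟩, by omega⟩
      rw [hact] at this
      simp at this
    set L := Finset.univ.filter fun u => u ∉ W ∧ deg F u ≤ 1 with hL
    obtain ⟨u, huL⟩ : L.Nonempty := by
      push Not at hdone
      obtain ⟨u, hu, hud⟩ := hdone
      have h2 := h.inv.forest.deg_le_two u
      refine ⟨u, ?_⟩
      rw [hL, Finset.mem_filter]
      refine ⟨Finset.mem_univ _, fun huW => ?_, by omega⟩
      have := hnact u hu (.inr (Finset.mem_sdiff.2 ⟨huW, hu⟩))
      omega
    have huW : u ∉ W := (Finset.mem_filter.1 huL).2.1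
    have hud : deg F u ≤ 1 := (Finset.mem_filter.1 huL).2.2
    have huB : deg (B ∪ X) u ≤ s := by
      by_contra hlt2
      push Not at hlt2
      have := hnact u (fun hm => huW (h.subset hm)) (.inl hlt2)
      omega
    have huM : deg M u ≤ 22 * s + 1 := by
      have h1 := h.inv.deg_maker_le u
      have h2 : deg (M.filter (· ∈ W.sym2)) u = 0 := by
        unfold deg
        rw [Finset.card_eq_zero, Finset.filter_eq_empty_iff]
        intro e he hue
        exact huW (Finset.mem_sym2_iff.1 (Finset.mem_filter.1 he).2 u hue)
      have hB : B.card ≤ 2 * s ^ 2 :=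
        h.inv.card_breaker.trans ((Nat.mul_le_mul_left b (by omega)).trans hsc.mul_le)
      have h3 := sum_deg_urgent_le h.inv.forest
        (card_urgent_le (S := W') h.inv.loopless_breaker hB h.card_sdiff_le)
      omega
    obtain ⟨c, hn, hcF, ht⟩ := h.inv.forest.exists_component hud
    -- claiming `uw` is possible for every end `w` of another path
    have key : ∀ w, w ∉ u :: c → deg F w ≤ 1 → s(u, w) ∉ B ∪ X → s(u, w) ∉ M →
        (∀ x ∈ P, x ≠ w) → (∀ x ∈ W', x = w → deg F x = 0) →
        (∑ x ∈ W', deg (insert s(u, w) F) x = 0 ∨ Fintype.card V +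
          ∑ x ∈ W', deg (insert s(u, w) F) x ≤ 30 * s + W'.card + (F.card + 1)) →
        ∃ e ∈ freeEdges M (B ∪ X), MakerWinsFrom b k (insert e M) (B ∪ X) := by
      intro w hwc hwd hwB hwM hwP hwW' hatt
      have huw : u ≠ w := by rintro rfl; simp at hwc
      have he : s(u, w) ∈ freeEdges M (B ∪ X) := mem_freeEdges.2 ⟨huw, hwM, hwB⟩
      have hF := h.inv.forest.insert_edge hn hcF ht hwc hud hwd
      have hnotF : s(u, w) ∉ F := fun hm => hwM (h.inv.subset hm)
      have heW : s(u, w) ∉ W.sym2 := by rw [Finset.mk_mem_sym2_iff]; tauto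
      have hdeg : ∀ x ∈ W', deg (insert s(u, w) F) x = deg F x + if x = w then 1 else 0 := by
        intro x hx
        rw [deg_insert hnotF]
        have : x ≠ u := by rintro rfl; exact huW (h.subset hx)
        simp [Sym2.mem_iff, this]
      have hcardM : (insert s(u, w) M).card = M.card + 1 := Finset.card_insert_of_notMem hwM
      refine ⟨s(u, w), he, ih _ _ (insert s(u, w) F) ⟨?_, h.subset, h.pivots_subset, h.card_le,
        h.card_sdiff_le, h.le_card_targets, h.expander.mono (Finset.subset_insert _ _), ?_, ?_, ?_⟩
        (by omega)⟩
      · refine h.inv.of_active_eq_empty hXb hXd hact he (Finset.subset_insert _ _) hF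
          (Finset.insert_subset_insert _ h.inv.subset) ?_ ?_ (.inr (Finset.mem_insert_self _ _))
        · intro f hf
          rw [Finset.mem_insert] at hf
          rcases hf with rfl | hf
          · exact heW
          · exact h.inv.forest_core f hf
        · rw [Finset.filter_insert, if_neg heW]
          exact h.inv.card_core
      · intro x hx
        rw [hdeg x (h.pivots_subset hx), if_neg (hwP x hx), h.deg_pivot x hx]
      · intro x hx
        rw [hdeg x hx]
        have h1 := h.deg_core x hx
        have h2 := hwW' x hx
        split_ifs with h3
        · rw [h2 h3]
        · omega
      · rw [Finset.card_insert_of_notMem hnotF]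
        exact hatt
    by_cases hmany : 30 * s < L.card
    · -- two paths are merged directly
      obtain ⟨w, hwL, hw⟩ : ∃ w ∈ L, w ∉ {u} ∪ {(u :: c).getLast (by simp)} ∪
          (Finset.univ.filter fun x => s(u, x) ∈ B ∪ X) ∪
          (Finset.univ.filter fun x => s(u, x) ∈ M) := by
        by_contra hcon
        push Not at hcon
        have h1 := Finset.card_le_card (s := L) hcon
        have h2 := h1.trans ((Finset.card_union_le _ _).trans (Nat.add_le_add_right
          ((Finset.card_union_le _ _).trans (Nat.add_le_add_right (Finset.card_union_le _ _) _)) _))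
        have h3 := card_neighbors_le (B ∪ X) u
        have h4 := card_neighbors_le M u
        rw [Finset.card_singleton, Finset.card_singleton] at h2
        omega
      rw [hL, Finset.mem_filter] at hwL
      simp only [Finset.mem_union, Finset.mem_singleton, Finset.mem_filter, Finset.mem_univ,
        true_and, not_or] at hw
      have hwW' : w ∉ W' := fun hm => hwL.2.1 (h.subset hm)
      have hwF : s(u, w) ∉ F := fun hm => hw.2 (h.inv.subset hm)
      refine key w ?_ hwL.2.2 (by rw [Finset.mem_union]; exact not_or.2 hw.1.2) hw.2
        (fun x hx hxw => hwW' (hxw ▸ h.pivots_subset hx))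
        (fun x hx hxw => absurd (hxw ▸ hx) hwW') ?_
      · intro hwc
        rcases eq_head_or_getLast hn hcF hwc hwL.2.2 with h1 | h1
        · exact hw.1.1.1 h1
        · rw [List.getLast?_eq_getLast_of_ne_nil (by simp), Option.some.injEq] at h1
          exact hw.1.1.2 h1.symm
      · have hsum : ∑ x ∈ W', deg (insert s(u, w) F) x = ∑ x ∈ W', deg F x := by
          refine Finset.sum_congr rfl fun x hx => ?_
          rw [deg_insert hwF, if_neg, add_zero]
          rw [Sym2.mem_iff]
          rintro (rfl | rfl)
          · exact huW (h.subset hx)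
          · exact hwW' hx
        rw [hsum]
        exact h.attached.imp id (by omega)
    · -- few ends are left, and the path ending in `u` is attached to the core
      obtain ⟨w, hwT, hw⟩ : ∃ w ∈ W' \ P, w ∉ (W'.filter fun x => 0 < deg F x) ∪
          (Finset.univ.filter fun x => s(u, x) ∈ B ∪ X) ∪
          (Finset.univ.filter fun x => s(u, x) ∈ M) := by
        by_contra hcon
        push Not at hcon
        have h1 := Finset.card_le_card (s := W' \ P) hcon
        have h2 := h1.trans ((Finset.card_union_le _ _).trans (Nat.add_le_add_right
          (Finset.card_union_le _ _) _))
        have h3 := card_neighbors_le (B ∪ X) u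
        have h4 := card_neighbors_le M u
        have h5 : (W'.filter fun x => 0 < deg F x).card ≤ ∑ x ∈ W', deg F x := by
          rw [Finset.card_filter]
          refine Finset.sum_le_sum fun x _ => ?_
          split_ifs <;> omega
        have h6 := h.sum_deg_core_le
        have h7 := h.le_card_targets
        omega
      rw [Finset.mem_sdiff] at hwT
      simp only [Finset.mem_union, Finset.mem_filter, Finset.mem_univ,
        true_and, not_or, not_and] at hw
      have hw0 : deg F w = 0 := by
        have := hw.1.1 hwT.1
        omega
      have hwF : s(u, w) ∉ F := fun hm => hw.2 (h.inv.subset hm)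
      refine key w ?_ (by omega) (by rw [Finset.mem_union]; exact not_or.2 hw.1.2) hw.2
        (fun x hx hxw => hwT.2 (hxw ▸ hx)) (fun x _ hxw => hxw ▸ hw0) (.inr ?_)
      · intro hwc
        obtain ⟨l₁, l₂, hl⟩ := List.append_of_mem hwc
        have h1 := deg_mono hcF w
        rw [hl] at hn h1
        rw [deg_pathEdges hn, hw0] at h1
        rcases l₁ with _ | ⟨z, l₁⟩
        · simp only [List.nil_append, List.cons.injEq] at hl
          exact huW (h.subset (hl.1 ▸ hwT.1))
        · simp at h1
      · have hsum : ∑ x ∈ W', deg (insert s(u, w) F) x = ∑ x ∈ W', deg F x + 1 := by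
          rw [Finset.sum_congr rfl (g := fun x => deg F x + if x = w then 1 else 0)]
          · rw [Finset.sum_add_distrib, Finset.sum_ite_eq', if_pos hwT.1]
          · intro x hx
            rw [deg_insert hwF]
            have : x ≠ u := by rintro rfl; exact huW (h.subset hx)
            simp [Sym2.mem_iff, this]
        rw [hsum]
        rcases h.attached with h0 | h1
        · -- the first attachment: few ends remain
          have h2 := sum_deg h.inv.forest.loopless
          rw [← Finset.sum_add_sum_compl W', h0, zero_add] at h2
          have h3 : W'ᶜ.card * 2 ≤ ∑ v ∈ W'ᶜ, (deg F v + if v ∈ L then 2 else 0) := by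
            rw [← smul_eq_mul]
            refine Finset.card_nsmul_le_sum _ _ _ fun v hv => ?_
            rw [Finset.mem_compl] at hv
            split_ifs with hvL
            · omega
            · by_cases hvW : v ∈ W
              · have := hnact v hv (.inr (Finset.mem_sdiff.2 ⟨hvW, hv⟩))
                omega
              · rw [hL, Finset.mem_filter] at hvL
                have : ¬ deg F v ≤ 1 := fun hm => hvL ⟨Finset.mem_univ _, hvW, hm⟩
                omega
          rw [Finset.sum_add_distrib] at h3
          have h4 : ∑ v ∈ W'ᶜ, (if v ∈ L then 2 else 0) ≤ L.card * 2 := by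
            refine (Finset.sum_le_sum_of_subset (Finset.subset_univ _)).trans ?_
            rw [← Finset.sum_filter]
            simp
          have h5 := Finset.card_add_card_compl W'
          omega
        · omega

end Attaching

/-! ### Building the core -/

section Core

variable {V : Type*} [Fintype V] [DecidableEq V]

/-- The pairs of disjoint `a`-subsets of `W` and of `P` that no edge of `M` joins. -/
def unjoinedPairs (M : Finset (Sym2 V)) (W P : Finset V) (a : ℕ) :
    Finset (Finset V × Finset V) :=
  (W.powerset ×ˢ P.powerset).filter fun p => Disjoint p.1 p.2 ∧ p.1.card = a ∧ p.2.card = a ∧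
    ∀ x ∈ p.1, ∀ y ∈ p.2, s(x, y) ∉ M

variable {b s K j a : ℕ} {W P : Finset V} {M B F : Finset (Sym2 V)}

theorem mem_unjoinedPairs {p : Finset V × Finset V} : p ∈ unjoinedPairs M W P a ↔
    (p.1 ⊆ W ∧ p.2 ⊆ P) ∧ Disjoint p.1 p.2 ∧ p.1.card = a ∧ p.2.card = a ∧
      ∀ x ∈ p.1, ∀ y ∈ p.2, s(x, y) ∉ M := by
  simp [unjoinedPairs]

theorem unjoinedPairs_anti {M' : Finset (Sym2 V)} (h : M ⊆ M') :
    unjoinedPairs M' W P a ⊆ unjoinedPairs M W P a := by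
  intro p hp
  rw [mem_unjoinedPairs] at hp ⊢
  exact ⟨hp.1, hp.2.1, hp.2.2.1, hp.2.2.2.1, fun x hx y hy hm => hp.2.2.2.2 x hx y hy (h hm)⟩

/-- Some unclaimed core edge joins at least one in `10000` of the unjoined pairs, because a random
pair of core vertices does so on average. -/
theorem exists_core_edge (hs : 1 ≤ s) (hPW : P ⊆ W) (hW : W.card ≤ 200 * s) (hP : P.card ≤ 100 * s)
    (hB : B.card ≤ 2 * s ^ 2) (hne : (unjoinedPairs M W P (3 * s)).Nonempty) :
    ∃ e ∈ freeEdges M B, e ∈ W.sym2 ∧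
      10000 * (unjoinedPairs (insert e M) W P (3 * s)).card ≤
        9999 * (unjoinedPairs M W P (3 * s)).card := by
  set U := unjoinedPairs M W P (3 * s) with hU
  set Q := (W ×ˢ P).filter fun q => s(q.1, q.2) ∉ B with hQ
  let r : Finset V × Finset V → V × V → Prop := fun p q => q.1 ∈ p.1 ∧ q.2 ∈ p.2
  have hdec : ∀ p q, Decidable (r p q) := fun p q => inferInstanceAs (Decidable (_ ∧ _))
  have hcount := Finset.sum_card_bipartiteAbove_eq_sum_card_bipartiteBelow (s := U) (t := Q) r
  have hlow : ∀ p ∈ U, 7 * s ^ 2 ≤ (Q.bipartiteAbove r p).card := by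
    intro p hp
    obtain ⟨⟨hp1, hp2⟩, hdis, hc1, hc2, -⟩ := mem_unjoinedPairs.1 hp
    have h1 : ((p.1 ×ˢ p.2).filter fun q => s(q.1, q.2) ∈ B).card ≤ B.card := by
      refine Finset.card_le_card_of_injOn (fun q => s(q.1, q.2))
        (fun q hq => (Finset.mem_filter.1 hq).2) ?_
      rintro ⟨x, y⟩ hx ⟨x', y'⟩ hx' h
      simp only [Finset.coe_filter, Finset.mem_product, Set.mem_ofPred_eq] at hx hx'
      simp only [Sym2.eq_iff] at h
      rcases h with ⟨rfl, rfl⟩ | ⟨rfl, rfl⟩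
      · rfl
      · exact absurd hx'.1.2 (Finset.disjoint_left.1 hdis hx.1.1)
    have h2 := Finset.card_filter_add_card_filter_not (s := p.1 ×ˢ p.2) fun q => s(q.1, q.2) ∈ B
    rw [Finset.card_product, hc1, hc2] at h2
    have h3 : ((p.1 ×ˢ p.2).filter fun q => s(q.1, q.2) ∉ B).card ≤
        (Q.bipartiteAbove r p).card := by
      refine Finset.card_le_card fun q hq => ?_
      simp only [Finset.mem_filter, Finset.mem_product] at hq
      simp only [Finset.mem_bipartiteAbove, hQ, Finset.mem_filter, Finset.mem_product]
      exact ⟨⟨⟨hp1 hq.1.1, hp2 hq.1.2⟩, hq.2⟩, hq.1⟩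
    nlinarith
  obtain ⟨q, hq, hqU⟩ : ∃ q ∈ Q, U.card ≤ 10000 * (U.bipartiteBelow r q).card := by
    by_contra hcon
    push Not at hcon
    have h1 := Finset.card_nsmul_le_sum U _ _ hlow
    rw [hcount, smul_eq_mul] at h1
    have h2 : ∑ q ∈ Q, 10000 * (U.bipartiteBelow r q).card ≤ Q.card * U.card := by
      rw [← smul_eq_mul]
      exact Finset.sum_le_card_nsmul _ _ _ fun q hq => (hcon q hq).le
    rw [← Finset.mul_sum] at h2
    have h3 : Q.card ≤ 20000 * s ^ 2 := by
      refine (Finset.card_filter_le _ _).trans ?_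
      rw [Finset.card_product]
      calc W.card * P.card ≤ (200 * s) * (100 * s) := Nat.mul_le_mul hW hP
        _ = 20000 * s ^ 2 := by ring
    have h4 : Q.card * U.card ≤ 20000 * s ^ 2 * U.card := Nat.mul_le_mul_right _ h3
    have h5 : 50000 * (s ^ 2 * U.card) ≤ 0 := by nlinarith
    have := hne.card_pos
    have : 0 < s ^ 2 * U.card := by positivity
    omega
  have hpos : 0 < (U.bipartiteBelow r q).card := by
    have := hne.card_pos
    omega
  obtain ⟨p, hp⟩ := Finset.card_pos.1 hpos
  rw [Finset.mem_bipartiteBelow] at hp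
  obtain ⟨⟨hp1, hp2⟩, hdis, -, -, hpM⟩ := mem_unjoinedPairs.1 hp.1
  have hqne : q.1 ≠ q.2 := fun h => Finset.disjoint_left.1 hdis hp.2.1 (h ▸ hp.2.2)
  rw [hQ, Finset.mem_filter, Finset.mem_product] at hq
  refine ⟨s(q.1, q.2), mem_freeEdges.2 ⟨hqne, hpM _ hp.2.1 _ hp.2.2, hq.2⟩, ?_, ?_⟩
  · rw [Finset.mk_mem_sym2_iff]
    exact ⟨hq.1.1, hPW hq.1.2⟩
  · have hsub : unjoinedPairs (insert s(q.1, q.2) M) W P (3 * s) ⊆ U \ U.bipartiteBelow r q := by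
      intro p hp
      rw [Finset.mem_sdiff, Finset.mem_bipartiteBelow]
      refine ⟨unjoinedPairs_anti (Finset.subset_insert _ _) hp, fun h => ?_⟩
      exact (mem_unjoinedPairs.1 hp).2.2.2.2 _ h.2.1 _ h.2.2 (Finset.mem_insert_self _ _)
    have h1 := Finset.card_le_card hsub
    have h2 : U.bipartiteBelow r q ⊆ U := Finset.filter_subset _ _
    rw [Finset.card_sdiff_of_subset h2] at h1
    have h3 := Finset.card_le_card h2
    omega

/-- Once every two large sets are joined, the removal of a largest poorly expanding set leaves an
expander, which may be chosen to avoid a given small set `Y`. -/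
theorem exists_expander (hPW : P ⊆ W) (hP : P.card = 100 * s) {Y : Finset V}
    (hY : Y.card ≤ 4 * s) (hM : unjoinedPairs M W P (3 * s) = ∅) :
    ∃ W' ⊆ W \ Y, (W \ W').card ≤ 7 * s ∧ IsExpander M W' (P ∩ W') (3 * s) := by
  let N : Finset V → Finset V := fun X => (P \ Y).filter fun x => x ∉ X ∧ ∃ y ∈ X, s(y, x) ∈ M
  let bad : Finset (Finset V) :=
    (W \ Y).powerset.filter fun X => X.card ≤ 3 * s ∧ (N X).card ≤ 3 * X.card
  have hbad : ∀ X, X ∈ bad ↔ X ⊆ W \ Y ∧ X.card ≤ 3 * s ∧ (N X).card ≤ 3 * X.card := by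
    intro X; simp [bad]
  obtain ⟨Z, hZ, hZmax⟩ := Finset.exists_max_image bad Finset.card
    ⟨∅, by rw [hbad]; simp [N]⟩
  rw [hbad] at hZ
  obtain ⟨hZW, hZs, hZN⟩ := hZ
  have hjoin : ∀ A B, A ⊆ W → B ⊆ P → Disjoint A B → 3 * s ≤ A.card → 3 * s ≤ B.card →
      ∃ x ∈ A, ∃ y ∈ B, s(x, y) ∈ M := by
    intro A B hA hB hd ha hb
    obtain ⟨A', hA', ha'⟩ := Finset.exists_subset_card_eq ha
    obtain ⟨B', hB', hb'⟩ := Finset.exists_subset_card_eq hb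
    by_contra hcon
    push Not at hcon
    have : (A', B') ∈ unjoinedPairs M W P (3 * s) := by
      rw [mem_unjoinedPairs]
      exact ⟨⟨hA'.trans hA, hB'.trans hB⟩, Finset.disjoint_of_subset_left hA'
        (Finset.disjoint_of_subset_right hB' hd), ha', hb',
        fun x hx y hy => hcon x (hA' hx) y (hB' hy)⟩
    rw [hM] at this
    simp at this
  refine ⟨(W \ Y) \ Z, Finset.sdiff_subset, ?_, ?_, ?_⟩
  · have : W \ ((W \ Y) \ Z) ⊆ Y ∪ Z := by
      intro x hx
      simp only [Finset.mem_sdiff, Finset.mem_union] at hx ⊢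
      tauto
    have := (Finset.card_le_card this).trans (Finset.card_union_le _ _)
    omega
  · intro X hX hne hXs
    by_contra hlt
    push Not at hlt
    have hXZ : Disjoint Z X := by
      rw [Finset.disjoint_left]
      intro x hx hx'
      exact (Finset.mem_sdiff.1 (hX hx')).2 hx
    have hcard := Finset.card_union_of_disjoint hXZ
    have hpos := hne.card_pos
    have hZXW : Z ∪ X ⊆ W \ Y := Finset.union_subset hZW (hX.trans Finset.sdiff_subset)
    have hN : (N (Z ∪ X)).card ≤ 3 * (Z ∪ X).card := by
      have hsub : N (Z ∪ X) ⊆ N Z ∪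
          (P ∩ ((W \ Y) \ Z)).filter fun x => x ∉ X ∧ ∃ y ∈ X, s(y, x) ∈ M := by
        intro x hx
        simp only [N, Finset.mem_filter, Finset.mem_sdiff, Finset.mem_union, not_or,
          Finset.mem_inter] at hx ⊢
        obtain ⟨⟨hxP, hxY⟩, ⟨hxZ, hxX⟩, y, hy | hy, hyx⟩ := hx
        · exact .inl ⟨⟨hxP, hxY⟩, hxZ, y, hy, hyx⟩
        · exact .inr ⟨⟨hxP, ⟨hPW hxP, hxY⟩, hxZ⟩, hxX, y, hy, hyx⟩
      have := (Finset.card_le_card hsub).trans (Finset.card_union_le _ _)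
      omega
    have hbig : 3 * s < (Z ∪ X).card := by
      by_contra hle
      push Not at hle
      have := hZmax (Z ∪ X) ((hbad _).2 ⟨hZXW, hle, hN⟩)
      omega
    obtain ⟨x, hx, y, hy, hxy⟩ := hjoin (Z ∪ X) ((P \ Y) \ (Z ∪ X ∪ N (Z ∪ X)))
      (hZXW.trans Finset.sdiff_subset) (Finset.sdiff_subset.trans Finset.sdiff_subset) (by
        rw [Finset.disjoint_left]
        intro x hx hx'
        exact (Finset.mem_sdiff.1 hx').2 (Finset.mem_union_left _ hx)) hbig.le (by
        have h1 := Finset.le_card_sdiff Y P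
        have h2 := Finset.le_card_sdiff (Z ∪ X ∪ N (Z ∪ X)) (P \ Y)
        have h3 := Finset.card_union_le (Z ∪ X) (N (Z ∪ X))
        omega)
    simp only [Finset.mem_sdiff, Finset.mem_union, not_or] at hy
    refine hy.2.2 ?_
    simp only [N, Finset.mem_filter, Finset.mem_sdiff, Finset.mem_union, not_or]
    exact ⟨hy.1, hy.2.1, x, Finset.mem_union.1 hx, hxy⟩
  · intro A hA B hB hd ha hb
    exact hjoin A B (hA.trans (Finset.sdiff_subset.trans Finset.sdiff_subset))
      (hB.trans Finset.inter_subset_left) hd ha hb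

/-- A positive number that starts below `2 ^ (300 s)` and decreases by the factor
`1 - 1 / 10000` can do so at most `3000000 s` times. -/
theorem le_of_decay {u : ℕ} (hu : 0 < u) (h : u * 10000 ^ j ≤ 2 ^ (300 * s) * 9999 ^ j) :
    j ≤ 3000000 * s := by
  have h1 : (u : ℝ) * 10000 ^ j ≤ 2 ^ (300 * s) * 9999 ^ j := by exact_mod_cast h
  have h2 : (1 : ℝ) ≤ u := by exact_mod_cast hu
  have h3 : (9999 : ℝ) ≤ 10000 * Real.exp (-(1 / 10000)) := by
    have := Real.add_one_le_exp (-(1 / 10000 : ℝ))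
    linarith
  have h4 : (2 : ℝ) ≤ Real.exp 1 := by
    have := Real.add_one_le_exp (1 : ℝ)
    linarith
  have h5 : (10000 : ℝ) ^ j ≤
      10000 ^ j * Real.exp ((300 * s : ℕ) * 1 + j * (-(1 / 10000))) := by
    calc (10000 : ℝ) ^ j = 1 * 10000 ^ j := (one_mul _).symm
      _ ≤ u * 10000 ^ j := by gcongr
      _ ≤ 2 ^ (300 * s) * 9999 ^ j := h1
      _ ≤ Real.exp 1 ^ (300 * s) * (10000 * Real.exp (-(1 / 10000))) ^ j := by gcongr
      _ = 10000 ^ j * Real.exp ((300 * s : ℕ) * 1 + j * (-(1 / 10000))) := by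
        rw [Real.exp_add, Real.exp_nat_mul, Real.exp_nat_mul, mul_pow]
        ring
  have h6 : 1 ≤ Real.exp ((300 * s : ℕ) * 1 + j * (-(1 / 10000))) :=
    le_of_mul_le_mul_left (by linarith) (pow_pos (by norm_num : (0 : ℝ) < 10000) j)
  rw [Real.one_le_exp_iff] at h6
  push_cast at h6
  have h7 : (j : ℝ) ≤ 3000000 * s := by linarith
  exact_mod_cast h7

/-- The phase of the game in which Maker builds the core: `j` counts the core edges, with each of
which the number of unjoined pairs decreases by a constant factor. -/
structure CorePhase (b s : ℕ) (W P : Finset V) (M B F : Finset (Sym2 V)) (j : ℕ) : Prop where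
  inv : Invariant b s W ∅ ∅ M B F j
  heavy : ∀ w ∈ W, 0 < deg F w → s < deg B w
  decay : (unjoinedPairs M W P (3 * s)).card * 10000 ^ j ≤ 2 ^ (300 * s) * 9999 ^ j
  le : j ≤ 3000000 * s + 1

/-- A finished core is turned into an expander by discarding few of its vertices. -/
theorem CorePhase.exists_attachingPhase (h : CorePhase b s W P M B F j)
    (hsc : Scale (Fintype.card V) b s K) (hPW : P ⊆ W) (hW : W.card = 200 * s)
    (hP : P.card = 100 * s) (hMK : M.card ≤ K) (hM : unjoinedPairs M W P (3 * s) = ∅) :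
    ∃ W' P', AttachingPhase b s W W' P' M B F := by
  have hs := hsc.one_le
  have hn := hsc.le_card
  have hB : B.card ≤ 2 * s ^ 2 :=
    h.inv.card_breaker.trans ((Nat.mul_le_mul_left b hMK).trans hsc.mul_le)
  have hY : (W.filter fun w => 0 < deg F w).card ≤ 4 * s := by
    refine (Finset.card_le_card fun w hw => ?_).trans (card_heavy_le h.inv.loopless_breaker hB)
    rw [Finset.mem_filter] at hw ⊢
    exact ⟨Finset.mem_univ _, h.heavy w hw.1 hw.2⟩
  obtain ⟨W', hW', hcard, hexp⟩ := exists_expander hPW hP hY hM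
  have hdeg : ∀ x ∈ W', deg F x = 0 := by
    intro x hx
    have := hW' hx
    rw [Finset.mem_sdiff, Finset.mem_filter] at this
    by_contra h0
    exact this.2 ⟨this.1, Nat.pos_of_ne_zero h0⟩
  refine ⟨W', P ∩ W', ⟨?_, hW'.trans Finset.sdiff_subset, Finset.inter_subset_right, hW.le, hcard,
    ?_, hexp, fun x hx => hdeg x (Finset.mem_inter.1 hx).2, fun x hx => by rw [hdeg x hx]; omega,
    .inl (Finset.sum_eq_zero hdeg)⟩⟩
  · refine ⟨h.inv.subset, h.inv.forest, h.inv.loopless_maker, h.inv.loopless_breaker,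
      h.inv.card_breaker, h.inv.forest_core, h.inv.card_core.trans h.le, ?_, ?_⟩
    · refine h.inv.card_discarded.trans (Finset.sum_le_sum_of_ne_zero fun v hv hv0 => ?_)
      simp only [urgent, Finset.mem_filter, Finset.mem_univ, true_and] at hv ⊢
      exact ⟨fun hvW => hv0 (hdeg v hvW), .inl (hv.2.resolve_right (by simp))⟩
    · have := h.inv.box.grow (c := 0) (A₁ := active s W' (W \ W') B F) (B' := B) (by omega)
        ((Finset.card_filter_le _ _).trans (card_urgent_le h.inv.loopless_breaker hB hcard)) ?_
        (fun A => le_rfl)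
      · simpa using this
      · intro v hv hv'
        simp only [active, urgent, Finset.mem_filter, Finset.mem_univ, true_and] at hv hv'
        by_contra hlt
        push Not at hlt
        exact hv' ⟨⟨by simp, .inl hlt⟩, hv.2⟩
  · have h1 := Finset.le_card_sdiff (W \ W') (W \ P)
    have h2 : (W \ P) \ (W \ W') ⊆ W' \ (P ∩ W') := by
      intro x hx
      simp only [Finset.mem_sdiff, Finset.mem_inter] at hx ⊢
      tauto
    have h3 := Finset.card_le_card h2
    have h4 := Finset.card_sdiff_of_subset hPW
    omega

theorem CorePhase.makerWinsFrom (hsc : Scale (Fintype.card V) b s K) (hPW : P ⊆ W)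
    (hW : W.card = 200 * s) (hP : P.card = 100 * s) :
    ∀ (k j : ℕ) (M B F : Finset (Sym2 V)), CorePhase b s W P M B F j → M.card + k = K →
      MakerWinsFrom b k M B := by
  intro k
  induction k with
  | zero =>
    intro j M B F h hMk
    have := h.inv.card_maker_lt hsc (by simp) h.le (by omega)
    omega
  | succ k ih =>
    intro j M B F h hMk
    rcases (unjoinedPairs M W P (3 * s)).eq_empty_or_nonempty with hM | hM
    · obtain ⟨W', P', h'⟩ := h.exists_attachingPhase hsc hPW hW hP (by omega) hM
      exact AttachingPhase.makerWinsFrom hsc _ M B F h' hMk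
    refine .inr fun X hX => ?_
    have hXb : X.card ≤ b := hX.2 ▸ min_le_left _ _
    have hXd : ∀ e ∈ X, ¬ e.IsDiag := fun e he => (not_mem_of_mem_freeEdges (hX.1 he)).1
    have hmono : ∀ w, deg B w ≤ deg (B ∪ X) w := deg_mono Finset.subset_union_left
    by_cases hact : (active s ∅ ∅ (B ∪ X) F).Nonempty
    · obtain ⟨v, hv, e, he, F', hinv, hdeg, -⟩ := h.inv.exists_urgent_move hsc hW.le
        (by simp) h.le (by omega) hXb hXd hact
      have hcardM : (insert e M).card = M.card + 1 :=
        Finset.card_insert_of_notMem (not_mem_of_mem_freeEdges he).2.1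
      refine ⟨e, he, ih j _ _ F' ⟨hinv, ?_, ?_, h.le⟩ (by omega)⟩
      · intro w hw hpos
        rw [hdeg w (Finset.mem_union_left _ hw)] at hpos
        by_cases hwv : w = v
        · subst hwv
          simp only [active, urgent, Finset.mem_filter] at hv
          exact hv.1.2.2.resolve_right (by simp)
        · rw [if_neg hwv, add_zero] at hpos
          exact (h.heavy w hw hpos).trans_le (hmono w)
      · exact (Nat.mul_le_mul_right _ (Finset.card_le_card
          (unjoinedPairs_anti (Finset.subset_insert _ _)))).trans h.decay
    rw [Finset.not_nonempty_iff_eq_empty] at hact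
    have hj : j ≤ 3000000 * s := le_of_decay hM.card_pos h.decay
    obtain ⟨e, he, heW, hdec⟩ := exists_core_edge (B := B ∪ X) hsc.one_le hPW hW.le hP.le
      (hsc.card_breaker_le h.inv.card_breaker hXb (by omega)) hM
    have hcardM : (insert e M).card = M.card + 1 :=
      Finset.card_insert_of_notMem (not_mem_of_mem_freeEdges he).2.1
    refine ⟨e, he, ih (j + 1) _ _ F ⟨?_, ?_, ?_, by omega⟩ (by omega)⟩
    · refine h.inv.of_active_eq_empty hXb hXd hact he subset_rfl h.inv.forest
        (h.inv.subset.trans (Finset.subset_insert _ _)) h.inv.forest_core ?_ (.inl heW)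
      rw [Finset.filter_insert, if_pos heW]
      exact (Finset.card_insert_le _ _).trans (Nat.succ_le_succ h.inv.card_core)
    · exact fun w hw hpos => (h.heavy w hw hpos).trans_le (hmono w)
    · have h1 := h.decay
      rw [pow_succ, pow_succ]
      calc (unjoinedPairs (insert e M) W P (3 * s)).card * (10000 ^ j * 10000)
          = (10000 * (unjoinedPairs (insert e M) W P (3 * s)).card) * 10000 ^ j := by ring
        _ ≤ (9999 * (unjoinedPairs M W P (3 * s)).card) * 10000 ^ j := by gcongr
        _ = 9999 * ((unjoinedPairs M W P (3 * s)).card * 10000 ^ j) := by ring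
        _ ≤ 9999 * (2 ^ (300 * s) * 9999 ^ j) := by gcongr
        _ = 2 ^ (300 * s) * (9999 ^ j * 9999) := by ring

/-- Maker wins within `K` turns whenever the scale `s` fits the bias. -/
theorem makerWinsFrom_of_scale (hsc : Scale (Fintype.card V) b s K) :
    MakerWinsFrom (V := V) b K ∅ ∅ := by
  have hn := hsc.le_card
  obtain ⟨W, -, hW⟩ := Finset.exists_subset_card_eq (s := (Finset.univ : Finset V)) (n := 200 * s)
    (by rw [Finset.card_univ]; omega)
  obtain ⟨P, hPW, hP⟩ := Finset.exists_subset_card_eq (s := W) (n := 100 * s) (by omega)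
  refine CorePhase.makerWinsFrom hsc hPW hW hP K 0 ∅ ∅ ∅ ⟨⟨subset_rfl, isLinearForest_empty,
    by simp, by simp, by simp, by simp, by simp, by simp, ?_⟩, ?_, ?_, by omega⟩ (by simp)
  · intro A hA
    have : active s ∅ ∅ (∅ : Finset (Sym2 V)) ∅ = ∅ := by simp [active, urgent, deg]
    rw [this, Finset.subset_empty] at hA
    subst hA
    simp [touch, boxBound]
  · simp [deg]
  · rw [pow_zero, pow_zero, mul_one, mul_one]
    refine (Finset.card_filter_le _ _).trans ?_
    rw [Finset.card_product, Finset.card_powerset, Finset.card_powerset, hW, hP, ← pow_add]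
    exact Nat.pow_le_pow_right (by norm_num) (by omega)

end Core

end HamiltonGame

theorem theorem1 :
    ∃ C : ℝ, 0 < C ∧ ∃ N : ℕ, ∀ n : ℕ, N ≤ n → ∀ b : ℕ,
      (b : ℝ) ≤ (n : ℝ) / Real.log n - C * n / (Real.log n) ^ (3 / 2 : ℝ) →
      ∃ k : ℕ, (k : ℝ) ≤ n + C * n / Real.sqrt (Real.log n) ∧
        HamiltonGame.MakerWinsWithin n b k := by
  -- `16000000 = 2 * 8000000` makes `ln n` so large that fewer than `2 n` turns are played
  obtain ⟨N, hN⟩ := Filter.eventually_atTop.1 ((Real.tendsto_log_atTop.comp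
    tendsto_natCast_atTop_atTop).eventually_ge_atTop ((16000000 : ℝ) ^ 2))
  have hN' : ∀ n : ℕ, N ≤ n → (16000000 : ℝ) ^ 2 ≤ Real.log n := fun n hn => hN n hn
  refine ⟨8000003, by norm_num, N, fun n hn b hb => ?_⟩
  set L := Real.log n with hL
  have hLbig := hN' n hn
  have hL0 : 0 < L := lt_of_lt_of_le (by norm_num) hLbig
  set r := Real.sqrt L with hr
  have hrr : r * r = L := Real.mul_self_sqrt hL0.le
  have hr0 : 0 < r := Real.sqrt_pos.2 hL0
  have hrbig : (16000000 : ℝ) ≤ r := Real.le_sqrt_of_sq_le hLbig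
  have hn0 : (0 : ℝ) < n := by
    rcases Nat.eq_zero_or_pos n with rfl | h
    · simp [hL] at hL0
    · exact_mod_cast h
  have hpow : L ^ (3 / 2 : ℝ) = L * r := by
    rw [show (3 / 2 : ℝ) = 1 + 1 / 2 by norm_num, Real.rpow_add hL0, Real.rpow_one,
      ← Real.sqrt_eq_rpow]
  rw [hpow] at hb
  -- the scale `s` is `n / √(ln n)` rounded up
  set q := (n : ℝ) / r with hq
  have hqL : q * r = n := by rw [hq]; field_simp
  have hLn : L ≤ n := (Real.log_le_sub_one_of_pos hn0).trans (by linarith)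
  have hq1 : 1 ≤ q := by
    rw [hq, le_div_iff₀ hr0]
    nlinarith
  set s := ⌈q⌉₊ with hs
  have hsq : q ≤ s := Nat.le_ceil q
  have hsq' : (s : ℝ) ≤ 2 * q := by
    have := Nat.ceil_lt_add_one (zero_le_one.trans hq1)
    linarith
  have hbL : (b : ℝ) * L ≤ n - 8000003 * q := by
    calc (b : ℝ) * L ≤ (n / L - 8000003 * n / (L * r)) * L := by gcongr
      _ = n - 8000003 * q := by rw [hq]; field_simp
  have hbr : (b : ℝ) * r ≤ q := by
    have h1 : (b : ℝ) * r * r ≤ q * r := by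
      rw [mul_assoc, hrr, hqL]
      linarith
    exact le_of_mul_le_mul_right h1 hr0
  have hbq : (b : ℝ) ≤ q := by nlinarith [Nat.cast_nonneg (α := ℝ) b]
  refine ⟨n + 4000000 * s, ?_, ?_⟩
  · push_cast
    have : 8000003 * (n : ℝ) / r = 8000003 * q := by rw [hq]; ring
    rw [this]
    linarith
  · refine HamiltonGame.makerWinsFrom_of_scale (s := s) ?_
    rw [Fintype.card_fin]
    refine ⟨?_, ?_, le_rfl, ?_⟩
    · exact_mod_cast hq1.trans hsq
    · have h1 : (n : ℝ) + 4000000 * s ≤ 2 * n := by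
        have : 16000000 * q ≤ q * r := by nlinarith
        linarith
      have h2 : (b : ℝ) * (n + 4000000 * s) ≤ 2 * s ^ 2 := by
        calc (b : ℝ) * (n + 4000000 * s) ≤ b * (2 * n) := by gcongr
          _ = 2 * q * (b * r) := by rw [← hqL]; ring
          _ ≤ 2 * q * q := by gcongr
          _ ≤ 2 * s ^ 2 := by nlinarith
      exact_mod_cast h2
    · rw [← hL]
      nlinarith
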